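/- All Hilbert spaces are finite-dimensional. Let $\rho_{\rm in}$ be a density matrix on $A\otimes\bar A$ and let $U: A\otimes\bar A\to B\otimes\bar B$ be a unitary time evolution, where $A$ is a region at the initial time, $B$ a region at the final time, and $\bar A,\bar B$ are their complements. Write $\rho_{B,0}={\rm tr}_{\bar B}(U\rho_{\rm in}U^\dagger)$. For $N\ge 1$, a coupling consists of an ancilla $W$ of arbitrary finite dimension, a pure initial state $|\phi\rangle$ of $W$, and a unitary $V$ on $A^{N}\otimes W$. Its connected state is $$\rho_{B^NW}={\rm tr}_{\bar B^N}\big[(U^{\otimes N}\otimes 1_W)\,V\,(\rho_{\rm in}^{\otimes N}\otimes|\phi\rangle\langle\phi|)\,V^\dagger\,(U^{\otimes N}\otimes 1_W)^\dagger\big],$$ with $V$ acting as the identity on $\bar A^N$. Put $\rho_W={\rm tr}_{B^N}\rho_{B^NW}$, $\rho_{B^N}={\rm tr}_{W}\rho_{B^NW}$. The space-time mutual information of $N$ copies is $$J_N(A:B)=\frac1N\sup S\big(\rho_{B^NW}\,\big|\,\rho_{B,0}^{\otimes N}\otimes\rho_W\big),$$ the supremum being over all couplings, where $S(\rho|\sigma)={\rm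 tr}(\rho\log\rho-\rho\log\sigma)$ is the relative entropy ($+\infty$ if the support of $\rho$ is not contained in that of $\sigma$). Suppose that $A$ and $B$ are spacelike separated, i.e. $[X_A\otimes 1_{\bar A},\,U^\dagger(Y_B\otimes 1_{\bar B})U]=0$ for all operators $X_A$ on $A$ and $Y_B$ on $B$. Then: 1. There is a unique joint state $\rho_{AB}$, i.e. a density matrix on $A\otimes B$ with ${\rm tr}[\rho_{AB}(X_A\otimes Y_B)]={\rm tr}[\rho_{\rm in}(X_A\otimes 1_{\bar A})U^\dagger(Y_B\otimes 1_{\bar B})U]$ for all $X_A$, $Y_B$. 2. Operations on $A$ do not affect $B$: $\rho_{B^N}=\rho_{B,0}^{\otimes N}$ for every $N\ge1$ and every coupling. 3. For every $N\ge 1$, $J_N(A:B)=I(A:B)$, where $I(A:B)=S(\rho_A)+S(\rho_B)-S(\rho_{AB})$ is the ordinary mutual information of $\rho_{AB}$ and $S(\rho)=-{\rm tr}\,\rho\log\rho$. 4. For every $N\ge1$ the supremum is attained by the swap coupling: $W$ is a copy of $A^N$ in an arbitrary pure state and $V$ is the swap of $A^N$ with $W$. -/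

import Mathlib

open scoped Matrix Kronecker ComplexOrder

universe u

noncomputable section

namespace STMI

/-! ### Finite-dimensional states, entropies and relative entropy

A finite index type `α` stands for the Hilbert space `ℂ^α`; operators are matrices, and the tensor
product of two spaces is indexed by the product of the index types. -/

/-- A density matrix: positive semidefinite with trace one. -/
def IsDensity {α : Type*} [Fintype α] (ρ : Matrix α α ℂ) : Prop :=
  ρ.PosSemidef ∧ ρ.trace = 1

/-- Partial trace over the second tensor factor. -/
def traceRight {α β : Type*} [Fintype β] (M : Matrix (α × β) (α × β) ℂ) : Matrix α α ℂ :=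
  Matrix.of fun i j => ∑ k, M (i, k) (j, k)

/-- Partial trace over the first tensor factor. -/
def traceLeft {α β : Type*} [Fintype α] (M : Matrix (α × β) (α × β) ℂ) : Matrix β β ℂ :=
  Matrix.of fun i j => ∑ k, M (k, i) (k, j)

/-- The `N`-fold tensor power of a (possibly rectangular) matrix. -/
def tensorPow {α β : Type*} (N : ℕ) (M : Matrix α β ℂ) : Matrix (Fin N → α) (Fin N → β) ℂ :=
  Matrix.of fun x y => ∏ i, M (x i) (y i)

/-- Logarithm of a positive semidefinite matrix through the functional calculus. Since
`Real.log 0 = 0`, it vanishes on the kernel, so that `ρ log ρ` has the usual convention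
`0 log 0 = 0`. -/
def matLog {α : Type*} [Fintype α] [DecidableEq α] (ρ : Matrix α α ℂ) : Matrix α α ℂ :=
  cfc Real.log ρ

/-- Von Neumann entropy `-tr (ρ log ρ)`. -/
def entropy {α : Type*} [Fintype α] [DecidableEq α] (ρ : Matrix α α ℂ) : ℝ :=
  -(ρ * matLog ρ).trace.re

open Classical in
/-- Quantum relative entropy `tr (ρ log ρ - ρ log σ)`, which is `+∞` unless
`ker σ ⊆ ker ρ`, i.e. unless the support of `ρ` is contained in that of `σ`. -/
def relEntropy {α : Type*} [Fintype α] [DecidableEq α] (ρ σ : Matrix α α ℂ) : EReal :=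
  if ∀ v : α → ℂ, σ *ᵥ v = 0 → ρ *ᵥ v = 0 then
    (((ρ * matLog ρ - ρ * matLog σ).trace.re : ℝ) : EReal)
  else ⊤

/-- Ordinary mutual information `S(ρ_A) + S(ρ_B) - S(ρ_AB)` of a bipartite state. -/
def mutualInfo {α β : Type*} [Fintype α] [DecidableEq α] [Fintype β] [DecidableEq β]
    (ρ : Matrix (α × β) (α × β) ℂ) : ℝ :=
  entropy (traceRight ρ) + entropy (traceLeft ρ) - entropy ρ

/-! ### The physical system -/

/-- An initial state on `A ⊗ A'` (where `A'` is the complement of the region `A` at the initial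
time) together with a unitary evolution from `A ⊗ A'` to `B ⊗ B'` (where `B'` is the complement of
the region `B` at the final time). -/
structure System (A A' B B' : Type*) [Fintype A] [DecidableEq A] [Fintype A'] [DecidableEq A']
    [Fintype B] [DecidableEq B] [Fintype B'] [DecidableEq B'] where
  /-- the initial state -/
  rho : Matrix (A × A') (A × A') ℂ
  /-- the time evolution -/
  U : Matrix (B × B') (A × A') ℂ
  isDensity : IsDensity rho
  conjTranspose_mul_self : Uᴴ * U = 1
  mul_conjTranspose_self : U * Uᴴ = 1

/-- An ancilla together with its coupling to a system `X`: a finite-dimensional ancilla space `W`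
of any dimension, a unit vector `phi` of `W` (the initial pure state of the ancilla), and a unitary
`V` on `X ⊗ W`. -/
structure Coupling (X : Type u) [Fintype X] [DecidableEq X] where
  W : Type u
  [fintypeW : Fintype W]
  [decidableEqW : DecidableEq W]
  phi : W → ℂ
  norm_phi : ∑ w, ‖phi w‖ ^ 2 = 1
  V : Matrix (X × W) (X × W) ℂ
  unitary : V ∈ Matrix.unitaryGroup (X × W) ℂ

attribute [instance] Coupling.fintypeW Coupling.decidableEqW

/-- The swap operator `|x⟩|y⟩ ↦ |y⟩|x⟩` on `X ⊗ X`. -/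
def swapMatrix (X : Type*) [DecidableEq X] : Matrix (X × X) (X × X) ℂ :=
  (1 : Matrix (X × X) (X × X) ℂ).submatrix Prod.swap id

theorem swapMatrix_mem (X : Type*) [Fintype X] [DecidableEq X] :
    swapMatrix X ∈ Matrix.unitaryGroup (X × X) ℂ := by
  rw [Matrix.mem_unitaryGroup_iff, Matrix.star_eq_conjTranspose, swapMatrix,
    Matrix.conjTranspose_submatrix, Matrix.conjTranspose_one]
  change (1 : Matrix (X × X) (X × X) ℂ).submatrix Prod.swap (Equiv.refl _) *
    (1 : Matrix (X × X) (X × X) ℂ).submatrix (Equiv.refl _) Prod.swap = 1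
  rw [Matrix.submatrix_mul_equiv, Matrix.one_mul]
  exact Matrix.submatrix_one _ Prod.swap_injective

/-- The swap coupling: the ancilla is a copy of `X` in the pure state `phi`, and `V` is the swap. -/
def swapCoupling {X : Type u} [Fintype X] [DecidableEq X] (phi : X → ℂ)
    (h : ∑ x, ‖phi x‖ ^ 2 = 1) : Coupling X where
  W := X
  phi := phi
  norm_phi := h
  V := swapMatrix X
  unitary := swapMatrix_mem X

/-- Reordering of tensor factors: `(α ⊗ β)^N ⊗ W ≃ (α^N ⊗ W) ⊗ β^N`. -/
def regroup (N : ℕ) (α β W : Type*) :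
    (Fin N → α × β) × W ≃ ((Fin N → α) × W) × (Fin N → β) where
  toFun x := (((fun i => (x.1 i).1), x.2), fun i => (x.1 i).2)
  invFun y := ((fun i => (y.1.1 i, y.2 i)), y.1.2)
  left_inv _ := rfl
  right_inv _ := rfl

namespace System

variable {A : Type u} {A' B B' : Type*} [Fintype A] [DecidableEq A] [Fintype A'] [DecidableEq A']
  [Fintype B] [DecidableEq B] [Fintype B'] [DecidableEq B']

/-- The Heisenberg-picture operator `U† (Y ⊗ 1) U` of an operator `Y` on `B`. -/
def heisenberg (S : System A A' B B') (Y : Matrix B B ℂ) : Matrix (A × A') (A × A') ℂ :=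
  S.Uᴴ * (Y ⊗ₖ (1 : Matrix B' B' ℂ)) * S.U

/-- `A` and `B` are spacelike separated: every operator on `A` commutes with every
Heisenberg-evolved operator on `B`. -/
def Spacelike (S : System A A' B B') : Prop :=
  ∀ (X : Matrix A A ℂ) (Y : Matrix B B ℂ),
    Commute (X ⊗ₖ (1 : Matrix A' A' ℂ)) (S.heisenberg Y)

/-- `ρ` is a joint state of `A` and `B`: a density matrix on `A ⊗ B` that reproduces all the
correlation functions of an operator on `A` and an operator on `B`. -/
def IsJointState (S : System A A' B B') (ρ : Matrix (A × B) (A × B) ℂ) : Prop :=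
  IsDensity ρ ∧ ∀ (X : Matrix A A ℂ) (Y : Matrix B B ℂ),
    (ρ * (X ⊗ₖ Y)).trace =
      (S.rho * ((X ⊗ₖ (1 : Matrix A' A' ℂ)) * S.heisenberg Y)).trace

/-- The unperturbed evolved state of `B`. -/
def rhoB0 (S : System A A' B B') : Matrix B B ℂ :=
  traceRight (S.U * S.rho * S.Uᴴ)

/-- The connected state on `B^N ⊗ W`: start from `N` copies of the initial state and the ancilla
state, apply `V` on `A^N ⊗ W`, evolve every copy with `U`, and trace out all the copies of `B'`. -/
def rhoBW (S : System A A' B B') (N : ℕ) (C : Coupling (Fin N → A)) :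
    Matrix ((Fin N → B) × C.W) ((Fin N → B) × C.W) ℂ :=
  let init : Matrix ((Fin N → A × A') × C.W) ((Fin N → A × A') × C.W) ℂ :=
    tensorPow N S.rho ⊗ₖ Matrix.vecMulVec C.phi (star C.phi)
  let couple : Matrix ((Fin N → A × A') × C.W) ((Fin N → A × A') × C.W) ℂ :=
    (C.V ⊗ₖ (1 : Matrix (Fin N → A') (Fin N → A') ℂ)).submatrix
      (regroup N A A' C.W) (regroup N A A' C.W)
  let evolve : Matrix ((Fin N → B × B') × C.W) ((Fin N → A × A') × C.W) ℂ :=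
    tensorPow N S.U ⊗ₖ (1 : Matrix C.W C.W ℂ)
  let final : Matrix ((Fin N → B × B') × C.W) ((Fin N → B × B') × C.W) ℂ :=
    (evolve * couple) * init * (evolve * couple)ᴴ
  traceRight (final.submatrix (regroup N B B' C.W).symm (regroup N B B' C.W).symm)

/-- Relative entropy between the connected state on `B^N ⊗ W` and the disconnected state
`ρ_{B,0}^{⊗N} ⊗ ρ_W`, where `ρ_W` is the reduced state of the ancilla after the coupling. -/
def couplingRelEntropy (S : System A A' B B') (N : ℕ) (C : Coupling (Fin N → A)) : EReal :=
  relEntropy (S.rhoBW N C) (tensorPow N S.rhoB0 ⊗ₖ traceLeft (S.rhoBW N C))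

/-- The space-time mutual information `J_N(A:B)` of `N` copies: `1/N` times the supremum of the
relative entropy over all ancillas and all couplings. -/
def J (S : System A A' B B') (N : ℕ) : EReal :=
  ((1 / (N : ℝ) : ℝ) : EReal) * ⨆ C : Coupling (Fin N → A), S.couplingRelEntropy N C

end System

end STMI

end

/-! Spacelike separation forces every Heisenberg operator of `B` to have the form `1 ⊗ Y'` on `A ⊗
A'`. Products of an operator on `A` with one on `B` then behave like operators on a tensor product,
so their correlations define a positive matrix `jointMatrix`; its entries are the expectations of
matrix units, which gives uniqueness.

A coupling acts only on the `A` side. Applying the isometry `V (1 ⊗ |φ⟩)` to `A^N` and discarding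
`A^N` afterwards is a channel from `A^N` to `W`, and `rhoBW_eq` identifies the connected state with
the image of `ρ_AB^{⊗N}` under this channel. Hence the marginal on `B^N` is untouched, and the
disconnected state is the image of `(ρ_A ⊗ ρ_B)^{⊗N}` under the same channel (`rhoBW_marginals_eq`).
Data processing and additivity bound the relative entropy by `N I(A:B)`. The swap moves `A^N` into
`W` without loss, so it attains the bound.

Data processing (`trace_relEntropy_traceLeft_le`) is proved from scratch. In the eigenbases `P`, `Q`
of `ρ`, `σ`, the relative entropy is `∑ w (log p - log q)` with weights `w j i = |⟨Q j, P i⟩|² p i`.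
This is the renormalized growth of `∑ w log (q + t p)` from `t = 0` to `t = ∞`, so it suffices to
compare the derivatives `∑ w p / (q + t p)`. Each derivative is the maximum over `X` of `quadForm t
ρ σ X`, and the Schwarz inequality for the dual of the channel shows that pulling `X` back can only
increase this form. -/

noncomputable section

set_option linter.unusedSectionVars false

namespace STMI

/-! ### Diagonalizations -/

section Diagonalization

variable {m k l : Type*} [Fintype m] [DecidableEq m] [Fintype k] [DecidableEq k]
  [Fintype l] [DecidableEq l]

/-- The (possibly rectangular) unitary `P` brings `ρ` into diagonal form, with real diagonal
entries `p`. -/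
structure Diagonalizes (P : Matrix m k ℂ) (p : k → ℝ) (ρ : Matrix m m ℂ) : Prop where
  conj_mul : Pᴴ * P = 1
  mul_conj : P * Pᴴ = 1
  eq : ρ = P * Matrix.diagonal (fun i => (p i : ℂ)) * Pᴴ

theorem exists_diagonalizes {ρ : Matrix m m ℂ} (h : ρ.PosSemidef) :
    ∃ (P : Matrix m m ℂ) (p : m → ℝ), Diagonalizes P p ρ ∧ ∀ i, 0 ≤ p i := by
  refine ⟨h.1.eigenvectorUnitary, h.1.eigenvalues, ⟨?_, ?_, ?_⟩, h.eigenvalues_nonneg⟩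
  · exact (Matrix.mem_unitaryGroup_iff'.1 h.1.eigenvectorUnitary.2)
  · exact (Matrix.mem_unitaryGroup_iff.1 h.1.eigenvectorUnitary.2)
  · conv_lhs => rw [h.1.spectral_theorem]
    rfl

namespace Diagonalizes

variable {P : Matrix m k ℂ} {p : k → ℝ} {ρ : Matrix m m ℂ}

theorem isHermitian (h : Diagonalizes P p ρ) : ρ.IsHermitian := by
  rw [h.eq]
  apply Matrix.isHermitian_mul_mul_conjTranspose
  rw [Matrix.IsHermitian, Matrix.diagonal_conjTranspose]
  congr 1
  ext i
  simp

theorem aeval_eq (h : Diagonalizes P p ρ) (q : Polynomial ℝ) :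
    Polynomial.aeval ρ q = P * Matrix.diagonal (fun i => ((q.eval (p i) : ℝ) : ℂ)) * Pᴴ := by
  induction q using Polynomial.induction_on' with
  | add q r hq hr =>
    rw [map_add, hq, hr, ← Matrix.add_mul, ← Matrix.mul_add, Matrix.diagonal_add]
    simp
  | monomial n a =>
    have hpow : ρ ^ n = P * Matrix.diagonal (fun i => ((p i ^ n : ℝ) : ℂ)) * Pᴴ := by
      induction n with
      | zero => simp [h.mul_conj]
      | succ n ih =>
        rw [pow_succ, ih]
        conv_lhs => rw [h.eq]
        calc _ = P * Matrix.diagonal (fun i => ((p i ^ n : ℝ) : ℂ)) * (Pᴴ * P) *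
              Matrix.diagonal (fun i => (p i : ℂ)) * Pᴴ := by simp only [Matrix.mul_assoc]
          _ = _ := by
            rw [h.conj_mul, Matrix.mul_one, Matrix.mul_assoc P, Matrix.diagonal_mul_diagonal]
            simp [pow_succ]
    rw [Polynomial.aeval_monomial, hpow, Algebra.algebraMap_eq_smul_one, Matrix.smul_mul,
      Matrix.one_mul, ← Matrix.smul_mul, ← Matrix.mul_smul, ← Matrix.diagonal_smul]
    congr 3
    ext i
    simp

/-- The spectrum is finite, so `f` may be replaced by an interpolating polynomial, for which
conjugation by `P` is immediate. -/
theorem cfc_eq (h : Diagonalizes P p ρ) (f : ℝ → ℝ) :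
    cfc f ρ = P * Matrix.diagonal (fun i => (f (p i) : ℂ)) * Pᴴ := by
  classical
  have hfin : (spectrum ℝ ρ).Finite := Matrix.finite_real_spectrum
  -- Taking both sets as nodes avoids having to identify the spectrum with the range of `p`.
  set s : Finset ℝ := hfin.toFinset ∪ Finset.univ.image p
  have hs : ∀ x ∈ s, (Lagrange.interpolate s id f).eval x = f x := fun x hx =>
    Lagrange.eval_interpolate_at_node (v := id) f (Function.injective_id.injOn) hx
  have h1 : cfc f ρ = cfc (Lagrange.interpolate s id f).eval ρ := by
    refine cfc_congr fun x hx => (hs x ?_).symm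
    simp only [s, Finset.mem_union, Set.Finite.mem_toFinset]
    exact Or.inl hx
  rw [h1, cfc_polynomial _ _ h.isHermitian.isSelfAdjoint, h.aeval_eq]
  congr 3
  ext i
  rw [hs (p i) (by simp [s])]

theorem matLog_eq (h : Diagonalizes P p ρ) :
    matLog ρ = P * Matrix.diagonal (fun i => (Real.log (p i) : ℂ)) * Pᴴ :=
  h.cfc_eq _

theorem trace_mul (h : Diagonalizes P p ρ) (Q : Matrix m l ℂ) (g : l → ℝ) :
    (ρ * (Q * Matrix.diagonal (fun j => (g j : ℂ)) * Qᴴ)).trace =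
      ((∑ j, ∑ i, ‖(Qᴴ * P) j i‖ ^ 2 * p i * g j : ℝ) : ℂ) := by
  have h1 : (ρ * (Q * Matrix.diagonal (fun j => (g j : ℂ)) * Qᴴ)).trace =
      ((Qᴴ * P) * (Matrix.diagonal (fun i => (p i : ℂ)) * ((Qᴴ * P)ᴴ *
        Matrix.diagonal (fun j => (g j : ℂ))))).trace := by
    rw [h.eq, ← Matrix.mul_assoc, Matrix.trace_mul_comm]
    simp only [Matrix.conjTranspose_mul, Matrix.conjTranspose_conjTranspose, Matrix.mul_assoc]
  rw [h1]
  simp only [Matrix.trace, Matrix.diag_apply]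
  push_cast
  refine Finset.sum_congr rfl fun j _ => ?_
  rw [Matrix.mul_apply]
  refine Finset.sum_congr rfl fun i _ => ?_
  rw [Matrix.diagonal_mul, Matrix.mul_diagonal, Matrix.conjTranspose_apply, RCLike.star_def,
    ← Complex.mul_conj']
  ring

theorem sum_row (h : Diagonalizes P p ρ) (Q : Matrix m l ℂ) (j : l) :
    ((∑ i, ‖(Qᴴ * P) j i‖ ^ 2 * p i : ℝ) : ℂ) = (Qᴴ * ρ * Q) j j := by
  have : Qᴴ * ρ * Q = (Qᴴ * P) * (Matrix.diagonal (fun i => (p i : ℂ)) * (Qᴴ * P)ᴴ) := by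
    rw [h.eq]
    simp only [Matrix.conjTranspose_mul, Matrix.conjTranspose_conjTranspose, Matrix.mul_assoc]
  rw [this, Matrix.mul_apply]
  push_cast
  refine Finset.sum_congr rfl fun i _ => ?_
  rw [Matrix.diagonal_mul, Matrix.conjTranspose_apply, RCLike.star_def, ← Complex.mul_conj']
  ring

theorem sum_col (h : Diagonalizes P p ρ) {Q : Matrix m l ℂ} (hQ : Q * Qᴴ = 1) (i : k) :
    ∑ j, ‖(Qᴴ * P) j i‖ ^ 2 = 1 := by
  have : (Qᴴ * P)ᴴ * (Qᴴ * P) = 1 := by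
    rw [Matrix.conjTranspose_mul, Matrix.conjTranspose_conjTranspose, Matrix.mul_assoc,
      ← Matrix.mul_assoc Q, hQ, Matrix.one_mul, h.conj_mul]
  have h2 := congrFun (congrFun this i) i
  rw [Matrix.mul_apply, Matrix.one_apply_eq] at h2
  have h3 : ((∑ j, ‖(Qᴴ * P) j i‖ ^ 2 : ℝ) : ℂ) = 1 := by
    rw [← h2]
    push_cast
    refine Finset.sum_congr rfl fun j _ => ?_
    rw [Matrix.conjTranspose_apply, RCLike.star_def, ← Complex.conj_mul']
  exact_mod_cast h3

theorem trace_eq (h : Diagonalizes P p ρ) : ρ.trace = ((∑ i, p i : ℝ) : ℂ) := by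
  rw [h.eq, Matrix.trace_mul_comm, ← Matrix.mul_assoc, h.conj_mul, Matrix.one_mul,
    Matrix.trace_diagonal]
  push_cast
  rfl

theorem entropy_eq (h : Diagonalizes P p ρ) :
    entropy ρ = -∑ i, p i * Real.log (p i) := by
  rw [entropy, h.matLog_eq, h.trace_mul, h.conj_mul, Complex.ofReal_re]
  congr 1
  refine Finset.sum_congr rfl fun i _ => ?_
  rw [Finset.sum_eq_single i (fun j _ hj => by simp [Matrix.one_apply_ne hj.symm]) (by simp)]
  simp

/-- Quantum relative entropy as a classical relative entropy, in terms of the overlaps of the two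
eigenbases. -/
theorem trace_relEntropy {Q : Matrix m l ℂ} {q : l → ℝ} {σ : Matrix m m ℂ}
    (h : Diagonalizes P p ρ) (h' : Diagonalizes Q q σ) :
    (ρ * matLog ρ - ρ * matLog σ).trace.re =
      ∑ j, ∑ i, ‖(Qᴴ * P) j i‖ ^ 2 * p i * (Real.log (p i) - Real.log (q j)) := by
  have h1 := h.entropy_eq
  rw [entropy] at h1
  rw [Matrix.trace_sub, Complex.sub_re, neg_inj.1 h1, h'.matLog_eq, h.trace_mul,
    Complex.ofReal_re]
  simp only [mul_sub, Finset.sum_sub_distrib]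
  congr 1
  rw [Finset.sum_comm]
  refine Finset.sum_congr rfl fun i _ => ?_
  rw [← Finset.sum_mul, ← Finset.sum_mul, h.sum_col h'.mul_conj, one_mul]

theorem mulVec_col {Q : Matrix m l ℂ} {q : l → ℝ} {σ : Matrix m m ℂ}
    (h' : Diagonalizes Q q σ) (j : l) : σ *ᵥ (fun x => Q x j) = fun x => q j * Q x j := by
  have : σ * Q = Q * Matrix.diagonal (fun i => (q i : ℂ)) := by
    rw [h'.eq, Matrix.mul_assoc, h'.conj_mul, Matrix.mul_one]
  ext x
  have h2 := congrFun (congrFun this x) j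
  rw [Matrix.mul_diagonal, mul_comm] at h2
  exact h2

/-- Inclusion of supports in terms of the overlaps of the two eigenbases. -/
theorem support_iff {Q : Matrix m l ℂ} {q : l → ℝ} {σ : Matrix m m ℂ}
    (h : Diagonalizes P p ρ) (h' : Diagonalizes Q q σ) :
    (∀ v : m → ℂ, σ *ᵥ v = 0 → ρ *ᵥ v = 0) ↔
      ∀ j i, q j = 0 → ‖(Qᴴ * P) j i‖ ^ 2 * p i = 0 := by
  have key : ∀ j i, (Pᴴ *ᵥ (ρ *ᵥ fun x => Q x j)) i = p i * star ((Qᴴ * P) j i) := by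
    intro j i
    have : Pᴴ * (ρ * Q) = Matrix.diagonal (fun i => (p i : ℂ)) * (Qᴴ * P)ᴴ := by
      rw [h.eq, Matrix.conjTranspose_mul, Matrix.conjTranspose_conjTranspose]
      simp only [← Matrix.mul_assoc]
      rw [h.conj_mul, Matrix.one_mul]
    have h2 := congrFun (congrFun this i) j
    rw [Matrix.diagonal_mul, Matrix.conjTranspose_apply] at h2
    exact h2
  constructor
  · intro hs j i hj
    have h0 := hs (fun x => Q x j) (by rw [h'.mulVec_col]; ext x; simp [hj])
    have h1 := key j i
    rw [h0, Matrix.mulVec_zero] at h1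
    rcases mul_eq_zero.1 h1.symm with h2 | h2
    · rw [Complex.ofReal_eq_zero.1 h2, mul_zero]
    · rw [star_eq_zero.1 h2]; simp
  · intro hw v hv
    have hcol : ∀ j, q j = 0 → ρ *ᵥ (fun x => Q x j) = 0 := by
      intro j hj
      have : Pᴴ *ᵥ (ρ *ᵥ fun x => Q x j) = 0 := by
        ext i
        rw [key]
        rcases mul_eq_zero.1 (hw j i hj) with h2 | h2
        · have : (Qᴴ * P) j i = 0 := by simpa using h2
          simp [this]
        · simp [h2]
      calc _ = (P * Pᴴ) *ᵥ (ρ *ᵥ fun x => Q x j) := by rw [h.mul_conj, Matrix.one_mulVec]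
        _ = 0 := by rw [← Matrix.mulVec_mulVec, this, Matrix.mulVec_zero]
    -- A vector in the kernel of `σ` has components only along the columns with `q j = 0`, and
    -- `hcol` shows that `ρ` kills those.
    have hzero : ∀ j, q j ≠ 0 → (Qᴴ *ᵥ v) j = 0 := by
      intro j hj
      have h1 : Qᴴ *ᵥ (σ *ᵥ v) = Matrix.diagonal (fun i => (q i : ℂ)) *ᵥ (Qᴴ *ᵥ v) := by
        rw [Matrix.mulVec_mulVec, Matrix.mulVec_mulVec, h'.eq, ← Matrix.mul_assoc,
          ← Matrix.mul_assoc, h'.conj_mul, Matrix.one_mul]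
      rw [hv, Matrix.mulVec_zero] at h1
      have h2 := congrFun h1 j
      rw [Matrix.mulVec_diagonal] at h2
      rcases mul_eq_zero.1 h2.symm with h3 | h3
      · exact absurd (Complex.ofReal_eq_zero.1 h3) hj
      · exact h3
    have hρQ : (ρ * Q) *ᵥ (Qᴴ *ᵥ v) = 0 := by
      ext x
      rw [Matrix.mulVec, dotProduct, Pi.zero_apply]
      refine Finset.sum_eq_zero fun j _ => ?_
      by_cases hj : q j = 0
      · have h4 : (ρ * Q) x j = 0 := congrFun (hcol j hj) x
        rw [h4, zero_mul]
      · rw [hzero j hj, mul_zero]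
    rw [Matrix.mulVec_mulVec, Matrix.mul_assoc, h'.mul_conj, Matrix.mul_one] at hρQ
    exact hρQ

end Diagonalizes

end Diagonalization

/-! ### Monotonicity of the relative entropy -/

/-- Positivity is asked only where the weight is nonzero: this is what the support condition
supplies when `σ` is singular. -/
theorem hasDerivAt_sum_mul_log {ι : Type*} [Fintype ι] {w p q : ι → ℝ}
    (hp : ∀ i, w i ≠ 0 → 0 < p i) (hq : ∀ i, w i ≠ 0 → 0 < q i) {t : ℝ} (ht : 0 ≤ t) :
    HasDerivAt (fun t => ∑ i, w i * Real.log (q i + t * p i))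
      (∑ i, w i * p i / (q i + t * p i)) t := by
  refine HasDerivAt.fun_sum fun i _ => ?_
  by_cases hwi : w i = 0
  · simpa [hwi] using hasDerivAt_const t (0 : ℝ)
  · have h0 : 0 < q i + t * p i := by have := hp i hwi; have := hq i hwi; positivity
    have h1 : HasDerivAt (fun t => q i + t * p i) (p i) t := by
      simpa using ((hasDerivAt_id t).mul_const (p i)).const_add (q i)
    rw [mul_div_assoc]
    exact (h1.log h0.ne').const_mul (w i)

/-- For `t > 0`, `log (q + t p) - log t = log (q / t + p)`. -/
theorem tendsto_sum_mul_log {ι : Type*} [Fintype ι] {w p q : ι → ℝ}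
    (hp : ∀ i, w i ≠ 0 → 0 < p i) (hq : ∀ i, w i ≠ 0 → 0 < q i) :
    Filter.Tendsto (fun t => ∑ i, w i * Real.log (q i + t * p i) - (∑ i, w i) * Real.log t)
      Filter.atTop (nhds (∑ i, w i * Real.log (p i))) := by
  have : (fun t => ∑ i, w i * Real.log (q i + t * p i) - (∑ i, w i) * Real.log t)
      =ᶠ[Filter.atTop] fun t => ∑ i, w i * Real.log (q i * t⁻¹ + p i) := by
    filter_upwards [Filter.eventually_gt_atTop 0] with t ht
    rw [Finset.sum_mul, ← Finset.sum_sub_distrib]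
    refine Finset.sum_congr rfl fun i _ => ?_
    by_cases hwi : w i = 0
    · simp [hwi]
    · have h0 : 0 < q i + t * p i := by have := hp i hwi; have := hq i hwi; positivity
      rw [← mul_sub, ← Real.log_div h0.ne' ht.ne']
      congr 2
      field_simp
  refine Filter.Tendsto.congr' this.symm (tendsto_finsetSum _ fun i _ => ?_)
  by_cases hwi : w i = 0
  · simp [hwi]
  · refine Filter.Tendsto.const_mul _ (Filter.Tendsto.log ?_ (hp i hwi).ne')
    simpa using (tendsto_inv_atTop_zero.const_mul (q i)).add_const (p i)

/-- If all the sums `∑ w p / (q + t p)`, `t > 0`, decrease, then so does `∑ w log (p / q)`. -/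
theorem sum_mul_log_sub_log_le {ι κ : Type*} [Fintype ι] [Fintype κ]
    {w p q : ι → ℝ} {w' p' q' : κ → ℝ}
    (hp : ∀ i, w i ≠ 0 → 0 < p i) (hq : ∀ i, w i ≠ 0 → 0 < q i)
    (hp' : ∀ i, w' i ≠ 0 → 0 < p' i) (hq' : ∀ i, w' i ≠ 0 → 0 < q' i)
    (hw : ∑ i, w i = ∑ i, w' i)
    (hle : ∀ t : ℝ, 0 < t →
      ∑ i, w' i * p' i / (q' i + t * p' i) ≤ ∑ i, w i * p i / (q i + t * p i)) :
    ∑ i, w' i * (Real.log (p' i) - Real.log (q' i)) ≤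
      ∑ i, w i * (Real.log (p i) - Real.log (q i)) := by
  have hd := fun t (ht : (0 : ℝ) ≤ t) => hasDerivAt_sum_mul_log hp hq ht
  have hd' := fun t (ht : (0 : ℝ) ≤ t) => hasDerivAt_sum_mul_log hp' hq' ht
  have hl := tendsto_sum_mul_log hp hq
  have hl' := tendsto_sum_mul_log hp' hq'
  set H : ℝ → ℝ := fun t => ∑ i, w i * Real.log (q i + t * p i) -
    ∑ i, w' i * Real.log (q' i + t * p' i)
  have hH : ∀ t : ℝ, 0 ≤ t → HasDerivAt H (∑ i, w i * p i / (q i + t * p i) -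
      ∑ i, w' i * p' i / (q' i + t * p' i)) t := fun t ht => (hd t ht).sub (hd' t ht)
  have hmono : MonotoneOn H (Set.Ici 0) := by
    refine monotoneOn_of_deriv_nonneg (convex_Ici 0)
      (fun t ht => (hH t ht).continuousAt.continuousWithinAt) ?_ ?_
    · intro t ht
      rw [interior_Ici] at ht
      exact (hH t (le_of_lt ht)).differentiableAt.differentiableWithinAt
    · intro t ht
      rw [interior_Ici] at ht
      rw [(hH t (le_of_lt ht)).deriv]
      exact sub_nonneg.2 (hle t ht)
  -- The divergent `log t` terms cancel because the two total weights agree.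
  have hlim : Filter.Tendsto H Filter.atTop
      (nhds (∑ i, w i * Real.log (p i) - ∑ i, w' i * Real.log (p' i))) := by
    refine (hl.sub hl').congr fun t => ?_
    simp only [H, hw]
    ring
  have h0 : H 0 ≤ ∑ i, w i * Real.log (p i) - ∑ i, w' i * Real.log (p' i) := by
    refine ge_of_tendsto hlim ?_
    filter_upwards [Filter.eventually_ge_atTop 0] with t ht
    exact hmono Set.self_mem_Ici ht ht
  simp only [H, zero_mul, add_zero] at h0
  simp only [mul_sub, Finset.sum_sub_distrib]
  linarith

/-! ### Variational formula for the derivative of the interpolating sum -/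

section Monotonicity

variable {m k l : Type*} [Fintype m] [DecidableEq m] [Fintype k] [DecidableEq k]
  [Fintype l] [DecidableEq l]

/-- A quadratic functional whose supremum over `X` is
`tr ρ^(1/2) (L_σ R_ρ⁻¹ + t)⁻¹ ρ^(1/2)`, in terms of the left and right multiplications. -/
def quadForm (t : ℝ) (ρ σ X : Matrix m m ℂ) : ℝ :=
  2 * (Xᴴ * ρ).trace.re - (Xᴴ * σ * X).trace.re - t * (X * ρ * Xᴴ).trace.re

theorem trace_conjTranspose_mul_re (A B : Matrix l k ℂ) :
    (Aᴴ * B).trace.re = ∑ j, ∑ i, (star (A j i) * B j i).re := by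
  rw [Matrix.trace, Finset.sum_comm, Complex.re_sum]
  refine Finset.sum_congr rfl fun i _ => ?_
  rw [Matrix.diag_apply, Matrix.mul_apply, Complex.re_sum]
  rfl

variable {P : Matrix m k ℂ} {p : k → ℝ} {ρ : Matrix m m ℂ}
  {Q : Matrix m l ℂ} {q : l → ℝ} {σ : Matrix m m ℂ}

theorem Diagonalizes.sum_overlap (h : Diagonalizes P p ρ) (hQ : Q * Qᴴ = 1) :
    ((∑ j, ∑ i, ‖(Qᴴ * P) j i‖ ^ 2 * p i : ℝ) : ℂ) = ρ.trace := by
  rw [h.trace_eq, Finset.sum_comm]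
  congr 1
  refine Finset.sum_congr rfl fun i _ => ?_
  rw [← Finset.sum_mul, h.sum_col hQ, one_mul]

/-- In the coordinates `X = Q Y P†` the form decouples into one scalar quadratic per entry of `Y`.
-/
theorem quadForm_eq (h : Diagonalizes P p ρ) (h' : Diagonalizes Q q σ) (t : ℝ)
    (Y : Matrix l k ℂ) :
    quadForm t ρ σ (Q * Y * Pᴴ) = ∑ j, ∑ i,
      (2 * (star (Y j i) * (Qᴴ * P) j i).re * p i - (q j + t * p i) * ‖Y j i‖ ^ 2) := by
  have h1 : ((Q * Y * Pᴴ)ᴴ * ρ).trace.re =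
      ∑ j, ∑ i, (star (Y j i) * (Qᴴ * P) j i).re * p i := by
    have : ((Q * Y * Pᴴ)ᴴ * ρ).trace =
        (Yᴴ * (Qᴴ * P * Matrix.diagonal (fun i => (p i : ℂ)))).trace := by
      rw [h.eq, Matrix.conjTranspose_mul, Matrix.conjTranspose_mul,
        Matrix.conjTranspose_conjTranspose, Matrix.mul_assoc, Matrix.trace_mul_comm]
      simp only [Matrix.mul_assoc]
      rw [h.conj_mul, Matrix.mul_one]
    rw [this, trace_conjTranspose_mul_re]
    refine Finset.sum_congr rfl fun j _ => Finset.sum_congr rfl fun i _ => ?_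
    rw [Matrix.mul_diagonal, ← mul_assoc, Complex.re_mul_ofReal]
  have hn : ∀ z : ℂ, (star z * z).re = ‖z‖ ^ 2 := fun z => by
    rw [RCLike.star_def, Complex.conj_mul']
    exact_mod_cast Complex.ofReal_re _
  have h2 : ((Q * Y * Pᴴ)ᴴ * σ * (Q * Y * Pᴴ)).trace.re =
      ∑ j, ∑ i, q j * ‖Y j i‖ ^ 2 := by
    have : ((Q * Y * Pᴴ)ᴴ * σ * (Q * Y * Pᴴ)).trace =
        (Yᴴ * (Matrix.diagonal (fun i => (q i : ℂ)) * Y)).trace := by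
      rw [h'.eq, Matrix.conjTranspose_mul, Matrix.conjTranspose_mul,
        Matrix.conjTranspose_conjTranspose, Matrix.mul_assoc, Matrix.mul_assoc,
        Matrix.trace_mul_comm]
      have e : Yᴴ * Qᴴ * (Q * Matrix.diagonal (fun i => (q i : ℂ)) * Qᴴ * (Q * Y * Pᴴ)) * P =
          Yᴴ * ((Qᴴ * Q) * Matrix.diagonal (fun i => (q i : ℂ)) * (Qᴴ * Q) * Y * (Pᴴ * P)) := by
        simp only [Matrix.mul_assoc]
      rw [e, h.conj_mul, h'.conj_mul, Matrix.one_mul, Matrix.mul_one, Matrix.mul_one]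
    rw [this, trace_conjTranspose_mul_re]
    refine Finset.sum_congr rfl fun j _ => Finset.sum_congr rfl fun i _ => ?_
    rw [Matrix.diagonal_mul, mul_left_comm, Complex.re_ofReal_mul, hn]
  have h3 : ((Q * Y * Pᴴ) * ρ * (Q * Y * Pᴴ)ᴴ).trace.re =
      ∑ j, ∑ i, p i * ‖Y j i‖ ^ 2 := by
    have : ((Q * Y * Pᴴ) * ρ * (Q * Y * Pᴴ)ᴴ).trace =
        (Yᴴ * (Y * Matrix.diagonal (fun i => (p i : ℂ)))).trace := by
      rw [h.eq, Matrix.conjTranspose_mul, Matrix.conjTranspose_mul,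
        Matrix.conjTranspose_conjTranspose]
      have e : Q * Y * Pᴴ * (P * Matrix.diagonal (fun i => (p i : ℂ)) * Pᴴ) *
          (P * (Yᴴ * Qᴴ)) = Q *
          (Y * (Pᴴ * P) * Matrix.diagonal (fun i => (p i : ℂ)) * (Pᴴ * P) * Yᴴ * Qᴴ) := by
        simp only [Matrix.mul_assoc]
      rw [e, h.conj_mul, Matrix.mul_one, Matrix.mul_one, Matrix.trace_mul_comm,
        Matrix.mul_assoc _ Qᴴ, h'.conj_mul, Matrix.mul_one, Matrix.trace_mul_comm]
    rw [this, trace_conjTranspose_mul_re]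
    refine Finset.sum_congr rfl fun j _ => Finset.sum_congr rfl fun i _ => ?_
    rw [Matrix.mul_diagonal, ← mul_assoc, Complex.re_mul_ofReal, hn, mul_comm]
  rw [quadForm, h1, h2, h3]
  simp only [Finset.mul_sum, ← Finset.sum_sub_distrib]
  refine Finset.sum_congr rfl fun j _ => Finset.sum_congr rfl fun i _ => ?_
  ring

theorem quadForm_le (h : Diagonalizes P p ρ) (h' : Diagonalizes Q q σ) (hp : ∀ i, 0 ≤ p i)
    (hq : ∀ j, 0 ≤ q j) {t : ℝ} (ht : 0 < t) (X : Matrix m m ℂ) :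
    quadForm t ρ σ X ≤ ∑ j, ∑ i, ‖(Qᴴ * P) j i‖ ^ 2 * p i * p i / (q j + t * p i) := by
  have hX : X = Q * (Qᴴ * X * P) * Pᴴ := by
    have e : Q * (Qᴴ * X * P) * Pᴴ = (Q * Qᴴ) * X * (P * Pᴴ) := by simp only [Matrix.mul_assoc]
    rw [e, h.mul_conj, h'.mul_conj, Matrix.one_mul, Matrix.mul_one]
  rw [hX, quadForm_eq h h']
  refine Finset.sum_le_sum fun j _ => Finset.sum_le_sum fun i _ => ?_
  set y := (Qᴴ * X * P) j i
  set c := (Qᴴ * P) j i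
  have hre : (star y * c).re ≤ ‖y‖ * ‖c‖ := by
    refine (Complex.re_le_norm _).trans ?_
    rw [norm_mul, norm_star]
  -- If the denominator vanishes then so does `p i`, as `t > 0`; both sides are then `0` by the
  -- convention `x / 0 = 0`.
  rcases (add_nonneg (hq j) (mul_nonneg ht.le (hp i))).eq_or_lt with h0 | h0
  · have hpi : p i = 0 := by
      have := hq j
      have h2 : t * p i = 0 := le_antisymm (by linarith) (mul_nonneg ht.le (hp i))
      exact (mul_eq_zero.1 h2).resolve_left ht.ne'
    rw [← h0, hpi]
    simp
  · rw [le_div_iff₀ h0]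
    have h1 : (star y * c).re * p i ≤ ‖y‖ * ‖c‖ * p i := mul_le_mul_of_nonneg_right hre (hp i)
    have h2 := mul_le_mul_of_nonneg_right h1 h0.le
    nlinarith [sq_nonneg ((q j + t * p i) * ‖y‖ - ‖c‖ * p i)]

theorem exists_quadForm_eq (h : Diagonalizes P p ρ) (h' : Diagonalizes Q q σ)
    (hp : ∀ i, 0 ≤ p i) (hq : ∀ j, 0 ≤ q j) {t : ℝ} (ht : 0 < t) :
    ∃ X, quadForm t ρ σ X =
      ∑ j, ∑ i, ‖(Qᴴ * P) j i‖ ^ 2 * p i * p i / (q j + t * p i) := by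
  -- The critical point of each scalar quadratic `2 Re(ȳ c) p - (q + t p) |y|²` is `y = c p / (q + t
  -- p)`.
  refine ⟨Q * (Matrix.of fun j i => (Qᴴ * P) j i * ((p i / (q j + t * p i) : ℝ) : ℂ)) * Pᴴ, ?_⟩
  rw [quadForm_eq h h']
  refine Finset.sum_congr rfl fun j _ => Finset.sum_congr rfl fun i _ => ?_
  rw [Matrix.of_apply]
  set c := (Qᴴ * P) j i
  set r := p i / (q j + t * p i) with hr
  have h1 : (star (c * (r : ℂ)) * c).re = ‖c‖ ^ 2 * r := by
    have : star (c * (r : ℂ)) * c = ((‖c‖ ^ 2 * r : ℝ) : ℂ) := by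
      rw [star_mul, RCLike.star_def, Complex.conj_ofReal, mul_assoc,
        Complex.conj_mul']
      push_cast
      ring
    rw [this, Complex.ofReal_re]
  rw [h1, norm_mul, Complex.norm_real, mul_pow, Real.norm_eq_abs, sq_abs]
  rcases (add_nonneg (hq j) (mul_nonneg ht.le (hp i))).eq_or_lt with h0 | h0
  · rw [hr, ← h0]; simp
  · have h2 : (q j + t * p i) * r = p i := by rw [hr]; field_simp
    rw [mul_div_assoc, ← hr]
    linear_combination (-(‖c‖ ^ 2 * r)) * h2

end Monotonicity

/-! ### Data processing inequality -/

section DataProcessing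

variable {κ m n : Type*} [Fintype κ] [DecidableEq κ] [Fintype m] [DecidableEq m]
  [Fintype n] [DecidableEq n]

/-- The partial trace is dual to `X ↦ 1 ⊗ X`; this turns statements about output states into
statements about pulled-back observables. -/
theorem trace_mul_traceLeft (M : Matrix (κ × m) (κ × m) ℂ) (X : Matrix m m ℂ) :
    (X * traceLeft M).trace = (((1 : Matrix κ κ ℂ) ⊗ₖ X) * M).trace := by
  simp only [Matrix.trace, Matrix.diag_apply, Matrix.mul_apply, traceLeft, Matrix.of_apply,
    Fintype.sum_prod_type, Matrix.kroneckerMap_apply, Matrix.one_apply, ite_mul, one_mul, zero_mul,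
    Finset.mul_sum]
  rw [Finset.sum_comm' (t' := Finset.univ) (s' := fun _ => Finset.univ) (by simp)]
  rw [Finset.sum_comm]
  conv_rhs => rw [Finset.sum_comm]
  refine Finset.sum_congr rfl fun i _ => ?_
  simp
  rw [Finset.sum_comm]

theorem traceLeft_posSemidef {M : Matrix (κ × m) (κ × m) ℂ} (hM : M.PosSemidef) :
    (traceLeft M).PosSemidef := by
  have : traceLeft M = ∑ a, M.submatrix (fun i => (a, i)) (fun i => (a, i)) := by
    ext i j
    simp [traceLeft, Matrix.sum_apply]
  rw [this]
  exact Matrix.posSemidef_sum _ fun a _ => hM.submatrix _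

/-- The quadratic functional increases under pull-back along a channel in Stinespring form. -/
theorem quadForm_traceLeft_le {K : Matrix (κ × m) n ℂ} (hK : Kᴴ * K = 1) {ρ σ : Matrix n n ℂ}
    (hρ : ρ.PosSemidef) (hσ : σ.PosSemidef) {t : ℝ} (ht : 0 < t) (X : Matrix m m ℂ) :
    quadForm t (traceLeft (K * ρ * Kᴴ)) (traceLeft (K * σ * Kᴴ)) X ≤
      quadForm t ρ σ (Kᴴ * ((1 : Matrix κ κ ℂ) ⊗ₖ X) * K) := by
  set Z := Kᴴ * ((1 : Matrix κ κ ℂ) ⊗ₖ X) * K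
  have hZ : Zᴴ = Kᴴ * ((1 : Matrix κ κ ℂ) ⊗ₖ Xᴴ) * K := by
    simp only [Z, Matrix.conjTranspose_mul, Matrix.conjTranspose_conjTranspose,
      Matrix.conjTranspose_kronecker, Matrix.conjTranspose_one, Matrix.mul_assoc]
  have h1 : (Xᴴ * traceLeft (K * ρ * Kᴴ)).trace = (Zᴴ * ρ).trace := by
    rw [trace_mul_traceLeft, hZ, Matrix.mul_assoc K, ← Matrix.mul_assoc, Matrix.trace_mul_comm,
      Matrix.mul_assoc, Matrix.trace_mul_comm]
    simp only [Matrix.mul_assoc]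
  -- The Schwarz inequality `Φ(Y)† Φ(Y) ≤ Φ(Y† Y)` for `Φ(Y) = K† (1 ⊗ Y) K`, traced against `τ`.
  -- The defect is a positive term compressed by the projection `1 - K K†`.
  have schwarz : ∀ {τ : Matrix n n ℂ} (_ : τ.PosSemidef) (Y : Matrix m m ℂ),
      ((Kᴴ * ((1 : Matrix κ κ ℂ) ⊗ₖ Y) * K) * τ *
        (Kᴴ * ((1 : Matrix κ κ ℂ) ⊗ₖ Y) * K)ᴴ).trace.re ≤
      (Y * traceLeft (K * τ * Kᴴ) * Yᴴ).trace.re := by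
    intro τ hτ Y
    set T := (1 : Matrix κ κ ℂ) ⊗ₖ Y
    have hT : Tᴴ = (1 : Matrix κ κ ℂ) ⊗ₖ Yᴴ := by
      rw [Matrix.conjTranspose_kronecker, Matrix.conjTranspose_one]
    have hTT : (1 : Matrix κ κ ℂ) ⊗ₖ (Yᴴ * Y) = Tᴴ * T := by
      rw [hT, ← Matrix.mul_kronecker_mul, Matrix.one_mul]
    have e2 : (Y * traceLeft (K * τ * Kᴴ) * Yᴴ).trace = ((T * K) * τ * (T * K)ᴴ).trace := by
      rw [Matrix.trace_mul_comm, ← Matrix.mul_assoc, trace_mul_traceLeft, hTT, Matrix.mul_assoc,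
        Matrix.trace_mul_comm]
      simp only [Matrix.mul_assoc, Matrix.conjTranspose_mul]
    have hR : (1 - K * Kᴴ)ᴴ * (1 - K * Kᴴ) = 1 - K * Kᴴ := by
      have : K * Kᴴ * (K * Kᴴ) = K * Kᴴ := by
        rw [Matrix.mul_assoc, ← Matrix.mul_assoc Kᴴ, hK, Matrix.one_mul]
      simp [Matrix.sub_mul, Matrix.mul_sub, this]
    have e3 : ((T * K) * τ * (T * K)ᴴ).trace - ((Kᴴ * T * K) * τ * (Kᴴ * T * K)ᴴ).trace =
        (((1 - K * Kᴴ) * (T * K)) * τ * ((1 - K * Kᴴ) * (T * K))ᴴ).trace := by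
      have e4 : (((1 - K * Kᴴ) * (T * K)) * τ * ((1 - K * Kᴴ) * (T * K))ᴴ).trace =
          (((1 - K * Kᴴ)ᴴ * (1 - K * Kᴴ)) * ((T * K) * τ * (T * K)ᴴ)).trace := by
        rw [Matrix.conjTranspose_mul (1 - K * Kᴴ), ← Matrix.mul_assoc, Matrix.trace_mul_comm]
        simp only [Matrix.mul_assoc]
      have e5 : ((Kᴴ * T * K) * τ * (Kᴴ * T * K)ᴴ).trace =
          (K * Kᴴ * ((T * K) * τ * (T * K)ᴴ)).trace := by
        rw [Matrix.mul_assoc Kᴴ, Matrix.conjTranspose_mul Kᴴ, Matrix.conjTranspose_conjTranspose,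
          ← Matrix.mul_assoc, Matrix.trace_mul_comm]
        simp only [Matrix.mul_assoc]
      rw [e4, e5, hR, Matrix.sub_mul, Matrix.one_mul, Matrix.trace_sub]
    have h0 := (hτ.mul_mul_conjTranspose_same ((1 - K * Kᴴ) * (T * K))).trace_nonneg
    rw [← e3] at h0
    have h0' := (Complex.le_def.1 h0).1
    rw [Complex.sub_re, Complex.zero_re] at h0'
    rw [e2]
    linarith
  -- The `σ` term has `X†` on the left, so the inequality is used for `X†`; both quadratic terms
  -- enter `quadForm` with a minus sign, so the form increases under pull-back.
  have h2 := schwarz hσ Xᴴ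
  rw [Matrix.conjTranspose_conjTranspose, ← hZ, Matrix.conjTranspose_conjTranspose] at h2
  have h3 := mul_le_mul_of_nonneg_left (schwarz hρ X) ht.le
  rw [quadForm, quadForm, h1]
  linarith

/-- Data processing inequality for the relative entropy, for a channel in Stinespring form. -/
theorem trace_relEntropy_traceLeft_le {K : Matrix (κ × m) n ℂ} (hK : Kᴴ * K = 1)
    {ρ σ : Matrix n n ℂ} (hρ : ρ.PosSemidef) (hσ : σ.PosSemidef)
    (hs : ∀ v, σ *ᵥ v = 0 → ρ *ᵥ v = 0)
    (hs' : ∀ v, traceLeft (K * σ * Kᴴ) *ᵥ v = 0 → traceLeft (K * ρ * Kᴴ) *ᵥ v = 0) :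
    (traceLeft (K * ρ * Kᴴ) * matLog (traceLeft (K * ρ * Kᴴ)) -
      traceLeft (K * ρ * Kᴴ) * matLog (traceLeft (K * σ * Kᴴ))).trace.re ≤
    (ρ * matLog ρ - ρ * matLog σ).trace.re := by
  obtain ⟨P, p, hP, hp⟩ := exists_diagonalizes hρ
  obtain ⟨Q, q, hQ, hq⟩ := exists_diagonalizes hσ
  obtain ⟨P', p', hP', hp'⟩ :=
    exists_diagonalizes (traceLeft_posSemidef (hρ.mul_mul_conjTranspose_same K))
  obtain ⟨Q', q', hQ', hq'⟩ :=
    exists_diagonalizes (traceLeft_posSemidef (hσ.mul_mul_conjTranspose_same K))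
  rw [hP.support_iff hQ] at hs
  rw [hP'.support_iff hQ'] at hs'
  rw [hP.trace_relEntropy hQ, hP'.trace_relEntropy hQ']
  have htr : (traceLeft (K * ρ * Kᴴ)).trace = ρ.trace := by
    have := trace_mul_traceLeft (K * ρ * Kᴴ) 1
    rw [Matrix.one_mul, Matrix.one_kronecker_one, Matrix.one_mul] at this
    rw [this, Matrix.trace_mul_comm, ← Matrix.mul_assoc, hK, Matrix.one_mul]
  have := sum_mul_log_sub_log_le
    (w := fun x : n × n => ‖(Qᴴ * P) x.1 x.2‖ ^ 2 * p x.2) (p := fun x => p x.2)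
    (q := fun x => q x.1)
    (w' := fun x : m × m => ‖(Q'ᴴ * P') x.1 x.2‖ ^ 2 * p' x.2) (p' := fun x => p' x.2)
    (q' := fun x => q' x.1)
    (fun x hx => (hp x.2).lt_of_ne' (right_ne_zero_of_mul hx))
    (fun x hx => (hq x.1).lt_of_ne' fun h0 => hx (hs _ _ h0))
    (fun x hx => (hp' x.2).lt_of_ne' (right_ne_zero_of_mul hx))
    (fun x hx => (hq' x.1).lt_of_ne' fun h0 => hx (hs' _ _ h0))
    (by
      rw [Fintype.sum_prod_type, Fintype.sum_prod_type, ← Complex.ofReal_inj,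
        hP.sum_overlap hQ.mul_conj,
        hP'.sum_overlap hQ'.mul_conj, htr])
    (by
      intro t ht
      rw [Fintype.sum_prod_type, Fintype.sum_prod_type]
      -- The optimal `X` for the output states, once pulled back, is a competitor for the input
      -- states.
      obtain ⟨X, hX⟩ := exists_quadForm_eq hP' hQ' hp' hq' ht
      rw [← hX]
      exact (quadForm_traceLeft_le hK hρ hσ ht X).trans (quadForm_le hP hQ hp hq ht _))
  rwa [Fintype.sum_prod_type, Fintype.sum_prod_type] at this

end DataProcessing

/-! ### Tensor powers and products -/

section TensorPow

variable {α β γ : Type*} [Fintype α] [DecidableEq α] [Fintype β] [DecidableEq β]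
  [Fintype γ] [DecidableEq γ]

theorem tensorPow_mul (N : ℕ) (M : Matrix α β ℂ) (M' : Matrix β γ ℂ) :
    tensorPow N (M * M') = tensorPow N M * tensorPow N M' := by
  ext x y
  simp only [tensorPow, Matrix.of_apply, Matrix.mul_apply, ← Finset.prod_mul_distrib]
  rw [Finset.prod_univ_sum, Fintype.piFinset_univ]

theorem tensorPow_conjTranspose (N : ℕ) (M : Matrix α β ℂ) :
    tensorPow N Mᴴ = (tensorPow N M)ᴴ := by
  ext x y
  simp [tensorPow, Matrix.conjTranspose_apply]

theorem tensorPow_diagonal (N : ℕ) (d : α → ℂ) :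
    tensorPow N (Matrix.diagonal d) = Matrix.diagonal fun x => ∏ i, d (x i) := by
  ext x y
  rw [tensorPow, Matrix.of_apply, Matrix.diagonal_apply]
  split_ifs with h
  · simp [h]
  · obtain ⟨i, hi⟩ := Function.ne_iff.1 h
    exact Finset.prod_eq_zero (Finset.mem_univ i) (Matrix.diagonal_apply_ne _ hi)

theorem tensorPow_one (N : ℕ) : tensorPow N (1 : Matrix α α ℂ) = 1 := by
  rw [← Matrix.diagonal_one, tensorPow_diagonal]
  simp

theorem tensorPow_traceRight (N : ℕ) (M : Matrix (α × β) (α × β) ℂ) (x y : Fin N → α) :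
    tensorPow N (traceRight M) x y = ∑ b : Fin N → β, ∏ i, M (x i, b i) (y i, b i) := by
  simp only [tensorPow, traceRight, Matrix.of_apply]
  rw [Finset.prod_univ_sum, Fintype.piFinset_univ]

theorem tensorPow_traceLeft (N : ℕ) (M : Matrix (α × β) (α × β) ℂ) (x y : Fin N → β) :
    tensorPow N (traceLeft M) x y = ∑ a : Fin N → α, ∏ i, M (a i, x i) (a i, y i) := by
  simp only [tensorPow, traceLeft, Matrix.of_apply]
  rw [Finset.prod_univ_sum, Fintype.piFinset_univ]

theorem tensorPow_posSemidef (N : ℕ) {M : Matrix α α ℂ} (hM : M.PosSemidef) :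
    (tensorPow N M).PosSemidef := by
  obtain ⟨P, p, hP, hp⟩ := exists_diagonalizes hM
  rw [hP.eq, tensorPow_mul, tensorPow_mul, tensorPow_conjTranspose, tensorPow_diagonal]
  refine Matrix.PosSemidef.mul_mul_conjTranspose_same (Matrix.PosSemidef.diagonal fun x => ?_) _
  exact Finset.prod_nonneg fun i _ => by simpa using hp (x i)

namespace Diagonalizes

variable {m k m' k' : Type*} [Fintype m] [DecidableEq m] [Fintype k] [DecidableEq k]
  [Fintype m'] [DecidableEq m'] [Fintype k'] [DecidableEq k']
  {P : Matrix m k ℂ} {p : k → ℝ} {ρ : Matrix m m ℂ}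
  {Q : Matrix m' k' ℂ} {q : k' → ℝ} {σ : Matrix m' m' ℂ}

theorem tensorPow (N : ℕ) (h : Diagonalizes P p ρ) :
    Diagonalizes (tensorPow N P) (fun x => ∏ i, p (x i)) (tensorPow N ρ) where
  conj_mul := by rw [← tensorPow_conjTranspose, ← tensorPow_mul, h.conj_mul, tensorPow_one]
  mul_conj := by rw [← tensorPow_conjTranspose, ← tensorPow_mul, h.mul_conj, tensorPow_one]
  eq := by
    rw [h.eq, tensorPow_mul, tensorPow_mul, tensorPow_conjTranspose, tensorPow_diagonal]
    simp

theorem kronecker (h : Diagonalizes P p ρ) (h' : Diagonalizes Q q σ) :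
    Diagonalizes (P ⊗ₖ Q) (fun x => p x.1 * q x.2) (ρ ⊗ₖ σ) where
  conj_mul := by
    rw [Matrix.conjTranspose_kronecker, ← Matrix.mul_kronecker_mul, h.conj_mul, h'.conj_mul,
      Matrix.one_kronecker_one]
  mul_conj := by
    rw [Matrix.conjTranspose_kronecker, ← Matrix.mul_kronecker_mul, h.mul_conj, h'.mul_conj,
      Matrix.one_kronecker_one]
  eq := by
    rw [h.eq, h'.eq, Matrix.mul_kronecker_mul, Matrix.mul_kronecker_mul,
      Matrix.conjTranspose_kronecker, Matrix.diagonal_kronecker_diagonal]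
    simp

theorem submatrix (h : Diagonalizes P p ρ) (e : m' ≃ m) :
    Diagonalizes (P.submatrix e id) p (ρ.submatrix e e) where
  conj_mul := by
    rw [Matrix.conjTranspose_submatrix, Matrix.submatrix_mul_equiv, h.conj_mul,
      Matrix.submatrix_id_id]
  mul_conj := by
    rw [Matrix.conjTranspose_submatrix, ← Matrix.submatrix_mul _ _ _ _ _ Function.bijective_id,
      h.mul_conj, Matrix.submatrix_one_equiv]
  eq := by
    conv_lhs => rw [h.eq]
    rw [Matrix.conjTranspose_submatrix, Matrix.submatrix_mul _ _ _ _ _ Function.bijective_id,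
      Matrix.submatrix_mul _ _ _ _ _ Function.bijective_id, Matrix.submatrix_id_id]

end Diagonalizes

/-- The mean of a sum of `N` independent copies: in the term for the factor `k`, all the other
factors sum to `1`. -/
theorem sum_prod_mul_sum {ι : Type*} [Fintype ι] {w : ι → ℝ} (hw : ∑ i, w i = 1) (f : ι → ℝ)
    (N : ℕ) : ∑ x : Fin N → ι, (∏ k, w (x k)) * ∑ k, f (x k) = N * ∑ i, w i * f i := by
  classical
  have h : ∀ k : Fin N, ∑ x : Fin N → ι, (∏ k, w (x k)) * f (x k) = ∑ i, w i * f i := by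
    intro k
    have h1 : ∀ x : Fin N → ι, (∏ j, w (x j)) * f (x k) =
        ∏ j, (w (x j) * if j = k then f (x j) else 1) := by
      intro x
      rw [Finset.prod_mul_distrib]
      simp
    simp only [h1]
    have h2 := Finset.prod_univ_sum (fun _ : Fin N => (Finset.univ : Finset ι))
      (fun j i => w i * if j = k then f i else 1)
    rw [Fintype.piFinset_univ] at h2
    rw [← h2, Finset.prod_eq_single k]
    · simp
    · intro j _ hj
      simp [hj, hw]
    · simp
  simp only [Finset.mul_sum]
  rw [Finset.sum_comm]
  simp [h, Finset.mul_sum]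

/-- Overlap weights of tensor powers are products, so one vanishing eigenvalue of `σ` in the string
kills the whole weight. -/
theorem support_tensorPow (N : ℕ) {ρ σ : Matrix α α ℂ} (hρ : ρ.PosSemidef) (hσ : σ.PosSemidef)
    (hs : ∀ v, σ *ᵥ v = 0 → ρ *ᵥ v = 0) :
    ∀ v, tensorPow N σ *ᵥ v = 0 → tensorPow N ρ *ᵥ v = 0 := by
  obtain ⟨P, p, hP, hp⟩ := exists_diagonalizes hρ
  obtain ⟨Q, q, hQ, hq⟩ := exists_diagonalizes hσ
  rw [hP.support_iff hQ] at hs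
  rw [(hP.tensorPow N).support_iff (hQ.tensorPow N)]
  intro y x hy
  obtain ⟨i, -, hi⟩ := Finset.prod_eq_zero_iff.1 hy
  rw [← tensorPow_conjTranspose, ← tensorPow_mul, tensorPow, Matrix.of_apply, norm_prod,
    ← Finset.prod_pow, ← Finset.prod_mul_distrib]
  exact Finset.prod_eq_zero (Finset.mem_univ i) (hs _ _ hi)

/-- Additivity of the relative entropy. -/
theorem trace_relEntropy_tensorPow (N : ℕ) {ρ σ : Matrix α α ℂ} (hρ : IsDensity ρ)
    (hσ : σ.PosSemidef) (hs : ∀ v, σ *ᵥ v = 0 → ρ *ᵥ v = 0) :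
    (tensorPow N ρ * matLog (tensorPow N ρ) - tensorPow N ρ * matLog (tensorPow N σ)).trace.re =
      N * (ρ * matLog ρ - ρ * matLog σ).trace.re := by
  obtain ⟨P, p, hP, hp⟩ := exists_diagonalizes hρ.1
  obtain ⟨Q, q, hQ, hq⟩ := exists_diagonalizes hσ
  rw [hP.support_iff hQ] at hs
  rw [(hP.tensorPow N).trace_relEntropy (hQ.tensorPow N), hP.trace_relEntropy hQ]
  set w : α × α → ℝ := fun x => ‖(Qᴴ * P) x.1 x.2‖ ^ 2 * p x.2 with hw
  have hsum : ∑ x, w x = 1 := by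
    rw [Fintype.sum_prod_type, ← Complex.ofReal_inj]
    rw [hP.sum_overlap hQ.mul_conj, hρ.2, Complex.ofReal_one]
  have := sum_prod_mul_sum hsum (fun x => Real.log (p x.2) - Real.log (q x.1)) N
  rw [Fintype.sum_prod_type] at this
  rw [← this, ← (Equiv.arrowProdEquivProdArrow (Fin N) (fun _ => α) (fun _ => α)).symm.sum_comp,
    Fintype.sum_prod_type]
  refine Finset.sum_congr rfl fun y _ => Finset.sum_congr rfl fun x _ => ?_
  have hprod : ‖((STMI.tensorPow N Q)ᴴ * STMI.tensorPow N P) y x‖ ^ 2 * ∏ i, p (x i) =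
      ∏ i, w (y i, x i) := by
    rw [← tensorPow_conjTranspose, ← tensorPow_mul, STMI.tensorPow, Matrix.of_apply, norm_prod,
      ← Finset.prod_pow, ← Finset.prod_mul_distrib]
  rw [hprod]
  change _ = (∏ i, w (y i, x i)) * ∑ i, (Real.log (p (x i)) - Real.log (q (y i)))
  -- The logarithm of a product splits only when all eigenvalues are nonzero; the remaining terms
  -- carry zero weight.
  by_cases h0 : ∏ i, w (y i, x i) = 0
  · rw [h0, zero_mul, zero_mul]
  · have h1 : ∀ i, w (y i, x i) ≠ 0 := fun i => (Finset.prod_ne_zero_iff.1 h0) i (Finset.mem_univ i)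
    rw [Real.log_prod fun i _ => right_ne_zero_of_mul (h1 i),
      Real.log_prod fun i _ h2 => h1 i (hs _ _ h2), Finset.sum_sub_distrib]

end TensorPow

/-! ### Marginals and mutual information -/

section Marginals

variable {α β : Type*} [Fintype α] [DecidableEq α] [Fintype β] [DecidableEq β]

theorem trace_mul_traceRight (M : Matrix (α × β) (α × β) ℂ) (X : Matrix α α ℂ) :
    (X * traceRight M).trace = ((X ⊗ₖ (1 : Matrix β β ℂ)) * M).trace := by
  simp only [Matrix.trace, Matrix.diag_apply, Matrix.mul_apply, traceRight, Matrix.of_apply,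
    Fintype.sum_prod_type, Matrix.kroneckerMap_apply, Matrix.one_apply, mul_ite, ite_mul, mul_one,
    mul_zero, zero_mul, Finset.mul_sum]
  refine Finset.sum_congr rfl fun i _ => ?_
  rw [Finset.sum_comm]
  simp

theorem traceRight_posSemidef {M : Matrix (α × β) (α × β) ℂ} (hM : M.PosSemidef) :
    (traceRight M).PosSemidef := by
  have : traceRight M = ∑ b, M.submatrix (fun i => (i, b)) (fun i => (i, b)) := by
    ext i j
    simp [traceRight, Matrix.sum_apply]
  rw [this]
  exact Matrix.posSemidef_sum _ fun a _ => hM.submatrix _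

theorem trace_single_mul (k : α) (M : Matrix α α ℂ) :
    (Matrix.single k k 1 * M).trace = M k k := by
  rw [Matrix.trace_mul_comm, Matrix.trace_mul_single]
  simp

/-- Summing over a complete basis of the second factor is a partial trace, whatever the basis; with
`QA` diagonalizing the marginal, the overlap weights sum to its eigenvalues. -/
theorem sum_diag_right {QA : Matrix α α ℂ} {QB : Matrix β β ℂ} (hB : QB * QBᴴ = 1)
    (M : Matrix (α × β) (α × β) ℂ) (k : α) :
    ∑ l, ((QA ⊗ₖ QB)ᴴ * M * (QA ⊗ₖ QB)) (k, l) (k, l) = (QAᴴ * traceRight M * QA) k k := by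
  have h1 : (QAᴴ * traceRight M * QA) k k =
      ((QA * Matrix.single k k 1 * QAᴴ) * traceRight M).trace := by
    rw [← trace_single_mul k (QAᴴ * traceRight M * QA), ← Matrix.mul_assoc, Matrix.trace_mul_comm]
    simp only [Matrix.mul_assoc]
  have h2 : (QA * Matrix.single k k 1 * QAᴴ) ⊗ₖ (1 : Matrix β β ℂ) =
      (QA ⊗ₖ QB) * (Matrix.single k k 1 ⊗ₖ (1 : Matrix β β ℂ)) * (QA ⊗ₖ QB)ᴴ := by
    rw [Matrix.conjTranspose_kronecker, ← Matrix.mul_kronecker_mul, ← Matrix.mul_kronecker_mul,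
      Matrix.mul_one, hB]
  have h3 : ∀ T : Matrix (α × β) (α × β) ℂ,
      (((QA ⊗ₖ QB) * (Matrix.single k k 1 ⊗ₖ (1 : Matrix β β ℂ)) * (QA ⊗ₖ QB)ᴴ) * T).trace =
      ((Matrix.single k k 1 ⊗ₖ (1 : Matrix β β ℂ)) * ((QA ⊗ₖ QB)ᴴ * T * (QA ⊗ₖ QB))).trace := by
    intro T
    rw [Matrix.mul_assoc, Matrix.mul_assoc, Matrix.trace_mul_comm]
    simp only [Matrix.mul_assoc]
  rw [h1, trace_mul_traceRight, h2, h3, ← trace_mul_traceRight, trace_single_mul]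
  rfl

theorem sum_diag_left {QA : Matrix α α ℂ} {QB : Matrix β β ℂ} (hA : QA * QAᴴ = 1)
    (M : Matrix (α × β) (α × β) ℂ) (l : β) :
    ∑ k, ((QA ⊗ₖ QB)ᴴ * M * (QA ⊗ₖ QB)) (k, l) (k, l) = (QBᴴ * traceLeft M * QB) l l := by
  have h1 : (QBᴴ * traceLeft M * QB) l l =
      ((QB * Matrix.single l l 1 * QBᴴ) * traceLeft M).trace := by
    rw [← trace_single_mul l (QBᴴ * traceLeft M * QB), ← Matrix.mul_assoc, Matrix.trace_mul_comm]
    simp only [Matrix.mul_assoc]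
  have h2 : (1 : Matrix α α ℂ) ⊗ₖ (QB * Matrix.single l l 1 * QBᴴ) =
      (QA ⊗ₖ QB) * ((1 : Matrix α α ℂ) ⊗ₖ Matrix.single l l 1) * (QA ⊗ₖ QB)ᴴ := by
    rw [Matrix.conjTranspose_kronecker, ← Matrix.mul_kronecker_mul, ← Matrix.mul_kronecker_mul,
      Matrix.mul_one, hA]
  have h3 : ∀ T : Matrix (α × β) (α × β) ℂ,
      (((QA ⊗ₖ QB) * ((1 : Matrix α α ℂ) ⊗ₖ Matrix.single l l 1) * (QA ⊗ₖ QB)ᴴ) * T).trace =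
      (((1 : Matrix α α ℂ) ⊗ₖ Matrix.single l l 1) * ((QA ⊗ₖ QB)ᴴ * T * (QA ⊗ₖ QB))).trace := by
    intro T
    rw [Matrix.mul_assoc, Matrix.mul_assoc, Matrix.trace_mul_comm]
    simp only [Matrix.mul_assoc]
  rw [h1, trace_mul_traceLeft, h2, h3, ← trace_mul_traceLeft, trace_single_mul]
  rfl

theorem Diagonalizes.diag_eq {m k : Type*} [Fintype m] [DecidableEq m] [Fintype k] [DecidableEq k]
    {P : Matrix m k ℂ} {p : k → ℝ} {ρ : Matrix m m ℂ} (h : Diagonalizes P p ρ) (i : k) :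
    (Pᴴ * ρ * P) i i = p i := by
  have e : Pᴴ * ρ * P = (Pᴴ * P) * Matrix.diagonal (fun i => (p i : ℂ)) * (Pᴴ * P) := by
    rw [h.eq]
    simp only [Matrix.mul_assoc]
  rw [e, h.conj_mul, Matrix.one_mul, Matrix.mul_one, Matrix.diagonal_apply_eq]

variable {ρ : Matrix (α × β) (α × β) ℂ} {κ : Type*} [Fintype κ] [DecidableEq κ]
  {P : Matrix (α × β) κ ℂ} {p : κ → ℝ}
  {QA : Matrix α α ℂ} {qA : α → ℝ} {QB : Matrix β β ℂ} {qB : β → ℝ}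

theorem Diagonalizes.sum_right (hP : Diagonalizes P p ρ) (hA : Diagonalizes QA qA (traceRight ρ))
    (hB : QB * QBᴴ = 1) (k : α) :
    ∑ l, ∑ i, ‖((QA ⊗ₖ QB)ᴴ * P) (k, l) i‖ ^ 2 * p i = qA k := by
  rw [← Complex.ofReal_inj, ← hA.diag_eq, ← sum_diag_right hB, Complex.ofReal_sum]
  exact Finset.sum_congr rfl fun l _ => hP.sum_row _ _

theorem Diagonalizes.sum_left (hP : Diagonalizes P p ρ) (hB : Diagonalizes QB qB (traceLeft ρ))
    (hA : QA * QAᴴ = 1) (l : β) :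
    ∑ k, ∑ i, ‖((QA ⊗ₖ QB)ᴴ * P) (k, l) i‖ ^ 2 * p i = qB l := by
  rw [← Complex.ofReal_inj, ← hB.diag_eq, ← sum_diag_left hA, Complex.ofReal_sum]
  exact Finset.sum_congr rfl fun l _ => hP.sum_row _ _

/-- Nonnegative weights whose sum is a vanishing marginal eigenvalue must all vanish. -/
theorem Diagonalizes.overlap_eq_zero (hP : Diagonalizes P p ρ) (hp : ∀ i, 0 ≤ p i)
    (hA : Diagonalizes QA qA (traceRight ρ)) (hB : Diagonalizes QB qB (traceLeft ρ))
    (k : α) (l : β) (h0 : qA k * qB l = 0) (i : κ) :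
    ‖((QA ⊗ₖ QB)ᴴ * P) (k, l) i‖ ^ 2 * p i = 0 := by
  have hnn : ∀ (x : α × β) (i : κ), 0 ≤ ‖((QA ⊗ₖ QB)ᴴ * P) x i‖ ^ 2 * p i := fun x i =>
    mul_nonneg (sq_nonneg _) (hp i)
  have hrow : ∑ i, ‖((QA ⊗ₖ QB)ᴴ * P) (k, l) i‖ ^ 2 * p i = 0 := by
    rcases mul_eq_zero.1 h0 with h | h
    · rw [← hP.sum_right hA hB.mul_conj k] at h
      exact (Finset.sum_eq_zero_iff_of_nonneg fun l _ => Finset.sum_nonneg fun i _ => hnn _ i).1 h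
        l (Finset.mem_univ l)
    · rw [← hP.sum_left hB hA.mul_conj l] at h
      exact (Finset.sum_eq_zero_iff_of_nonneg fun k _ => Finset.sum_nonneg fun i _ => hnn _ i).1 h
        k (Finset.mem_univ k)
  exact (Finset.sum_eq_zero_iff_of_nonneg fun i _ => hnn _ i).1 hrow i (Finset.mem_univ i)

/-- The support of a bipartite state is contained in that of the product of its marginals. -/
theorem support_marginals (hρ : ρ.PosSemidef) :
    ∀ v, (traceRight ρ ⊗ₖ traceLeft ρ) *ᵥ v = 0 → ρ *ᵥ v = 0 := by
  obtain ⟨P, p, hP, hp⟩ := exists_diagonalizes hρ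
  obtain ⟨QA, qA, hA, -⟩ := exists_diagonalizes (traceRight_posSemidef hρ)
  obtain ⟨QB, qB, hB, -⟩ := exists_diagonalizes (traceLeft_posSemidef hρ)
  rw [hP.support_iff (hA.kronecker hB)]
  rintro ⟨k, l⟩ i h0
  exact hP.overlap_eq_zero hp hA hB k l h0 i

/-- The mutual information is the relative entropy with respect to the product of the marginals. -/
theorem trace_relEntropy_marginals (hρ : ρ.PosSemidef) :
    (ρ * matLog ρ - ρ * matLog (traceRight ρ ⊗ₖ traceLeft ρ)).trace.re = mutualInfo ρ := by
  obtain ⟨P, p, hP, hp⟩ := exists_diagonalizes hρ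
  obtain ⟨QA, qA, hA, -⟩ := exists_diagonalizes (traceRight_posSemidef hρ)
  obtain ⟨QB, qB, hB, -⟩ := exists_diagonalizes (traceLeft_posSemidef hρ)
  have h1 : (ρ * matLog (traceRight ρ ⊗ₖ traceLeft ρ)).trace.re =
      ∑ k, qA k * Real.log (qA k) + ∑ l, qB l * Real.log (qB l) := by
    rw [(hA.kronecker hB).matLog_eq, hP.trace_mul, Complex.ofReal_re]
    have h3 : ∀ x : α × β, ∑ i, ‖((QA ⊗ₖ QB)ᴴ * P) x i‖ ^ 2 * p i *
        Real.log (qA x.1 * qB x.2) =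
        (∑ i, ‖((QA ⊗ₖ QB)ᴴ * P) x i‖ ^ 2 * p i) * Real.log (qA x.1) +
        (∑ i, ‖((QA ⊗ₖ QB)ᴴ * P) x i‖ ^ 2 * p i) * Real.log (qB x.2) := by
      intro x
      rw [Finset.sum_mul, Finset.sum_mul, ← Finset.sum_add_distrib]
      refine Finset.sum_congr rfl fun i _ => ?_
      by_cases h0 : qA x.1 * qB x.2 = 0
      · rw [hP.overlap_eq_zero hp hA hB x.1 x.2 h0 i]
        ring
      · rw [Real.log_mul (left_ne_zero_of_mul h0) (right_ne_zero_of_mul h0)]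
        ring
    simp only [h3]
    rw [Finset.sum_add_distrib]
    congr 1
    · rw [Fintype.sum_prod_type]
      refine Finset.sum_congr rfl fun k _ => ?_
      exact (Finset.sum_mul _ _ _).symm.trans
        (congrArg (· * Real.log (qA k)) (hP.sum_right hA hB.mul_conj k))
    · rw [Fintype.sum_prod_type, Finset.sum_comm]
      refine Finset.sum_congr rfl fun l _ => ?_
      exact (Finset.sum_mul _ _ _).symm.trans
        (congrArg (· * Real.log (qB l)) (hP.sum_left hB hA.mul_conj l))
  rw [Matrix.trace_sub, Complex.sub_re, h1, mutualInfo, hA.entropy_eq, hB.entropy_eq, entropy]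
  ring

/-- The relative entropy does not depend on the labelling of the basis. -/
theorem relEntropy_submatrix {m n : Type*} [Fintype m] [DecidableEq m] [Fintype n] [DecidableEq n]
    {ρ σ : Matrix m m ℂ} (hρ : ρ.PosSemidef) (hσ : σ.PosSemidef) (e : n ≃ m) :
    relEntropy (ρ.submatrix e e) (σ.submatrix e e) = relEntropy ρ σ := by
  obtain ⟨P, p, hP, -⟩ := exists_diagonalizes hρ
  obtain ⟨Q, q, hQ, -⟩ := exists_diagonalizes hσ
  have hc : (Q.submatrix e id)ᴴ * P.submatrix e id = Qᴴ * P := by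
    rw [Matrix.conjTranspose_submatrix, Matrix.submatrix_mul_equiv, Matrix.submatrix_id_id]
  unfold relEntropy
  rw [(hP.submatrix e).trace_relEntropy (hQ.submatrix e), hP.trace_relEntropy hQ, hc]
  have h1 := (hP.submatrix e).support_iff (hQ.submatrix e)
  rw [hc] at h1
  simp only [h1, hP.support_iff hQ]

end Marginals

/-! ### The joint state of spacelike separated regions -/

namespace System

variable {A : Type u} {A' B B' : Type*} [Fintype A] [DecidableEq A] [Fintype A'] [DecidableEq A']
  [Fintype B] [DecidableEq B] [Fintype B'] [DecidableEq B'] (S : System A A' B B')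

theorem heisenberg_mul (Y Y' : Matrix B B ℂ) :
    S.heisenberg (Y * Y') = S.heisenberg Y * S.heisenberg Y' := by
  have h : S.heisenberg Y * S.heisenberg Y' =
      S.Uᴴ * (Y ⊗ₖ (1 : Matrix B' B' ℂ)) * (S.U * S.Uᴴ) * (Y' ⊗ₖ (1 : Matrix B' B' ℂ)) * S.U := by
    simp only [heisenberg, Matrix.mul_assoc]
  rw [h, S.mul_conjTranspose_self, Matrix.mul_one, Matrix.mul_assoc S.Uᴴ,
    ← Matrix.mul_kronecker_mul, Matrix.mul_one]
  rfl

theorem heisenberg_conjTranspose (Y : Matrix B B ℂ) :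
    (S.heisenberg Y)ᴴ = S.heisenberg Yᴴ := by
  simp only [heisenberg, Matrix.conjTranspose_mul, Matrix.conjTranspose_conjTranspose,
    Matrix.conjTranspose_kronecker, Matrix.conjTranspose_one, Matrix.mul_assoc]

theorem heisenberg_one : S.heisenberg (1 : Matrix B B ℂ) = 1 := by
  rw [heisenberg, Matrix.one_kronecker_one, Matrix.mul_one, S.conjTranspose_mul_self]

theorem heisenberg_zero : S.heisenberg (0 : Matrix B B ℂ) = 0 := by
  simp [heisenberg]

theorem heisenberg_add (Y Y' : Matrix B B ℂ) :
    S.heisenberg (Y + Y') = S.heisenberg Y + S.heisenberg Y' := by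
  simp [heisenberg, Matrix.add_kronecker, Matrix.mul_add, Matrix.add_mul]

theorem heisenberg_smul (c : ℂ) (Y : Matrix B B ℂ) :
    S.heisenberg (c • Y) = c • S.heisenberg Y := by
  simp [heisenberg, Matrix.smul_kronecker]

theorem heisenberg_single_apply (b b' : B) (s t : A × A') :
    S.heisenberg (Matrix.single b b' 1) s t = ∑ x, star (S.U (b, x) s) * S.U (b', x) t := by
  rw [heisenberg, Matrix.mul_assoc, Matrix.mul_apply, Fintype.sum_prod_type]
  rw [Finset.sum_eq_single b]
  · refine Finset.sum_congr rfl fun x _ => ?_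
    rw [Matrix.conjTranspose_apply, Matrix.mul_apply, Fintype.sum_prod_type]
    congr 1
    rw [Finset.sum_eq_single b', Finset.sum_eq_single x]
    · simp
    · intro y _ hy
      simp [Matrix.one_apply_ne hy.symm]
    · simp
    · intro c _ hc
      simp [hc.symm]
    · simp
  · intro c _ hc
    refine Finset.sum_eq_zero fun x _ => ?_
    rw [Matrix.mul_apply, Finset.sum_eq_zero, mul_zero]
    rintro ⟨d, y⟩ _
    simp [hc.symm]
  · simp

/-- The matrix of correlation functions of matrix units. -/
def jointMatrix : Matrix (A × B) (A × B) ℂ := Matrix.of fun x y =>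
  (S.rho * ((Matrix.single y.1 x.1 1 ⊗ₖ (1 : Matrix A' A' ℂ)) *
    S.heisenberg (Matrix.single y.2 x.2 1))).trace

/-- Both sides are bilinear in `X` and `Y`, and agree on matrix units by definition. Commutation
matters only for positivity. -/
theorem trace_jointMatrix_mul (X : Matrix A A ℂ) (Y : Matrix B B ℂ) :
    (S.jointMatrix * (X ⊗ₖ Y)).trace =
      (S.rho * ((X ⊗ₖ (1 : Matrix A' A' ℂ)) * S.heisenberg Y)).trace := by
  induction X using Matrix.induction_on' with
  | h_zero => simp
  | h_add X X' h h' =>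
    simp only [Matrix.add_kronecker, Matrix.mul_add, Matrix.add_mul, Matrix.trace_add, h, h']
  | h_std_basis a a' c =>
    induction Y using Matrix.induction_on' with
    | h_zero => simp [heisenberg_zero]
    | h_add Y Y' h h' =>
      simp only [Matrix.kronecker_add, Matrix.mul_add, heisenberg_add, Matrix.trace_add, h, h']
    | h_std_basis b b' d =>
      rw [Matrix.single_kronecker_single, Matrix.trace_mul_single]
      rw [show Matrix.single a a' c = c • Matrix.single a a' (1 : ℂ) by simp,
        show Matrix.single b b' d = d • Matrix.single b b' (1 : ℂ) by simp, heisenberg_smul,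
        Matrix.smul_kronecker, Matrix.smul_mul, Matrix.mul_smul, Matrix.mul_smul, Matrix.mul_smul,
        Matrix.trace_smul, Matrix.trace_smul]
      simp only [jointMatrix, Matrix.of_apply, smul_eq_mul]
      simp
      ring

theorem eq_jointMatrix {ρ : Matrix (A × B) (A × B) ℂ} (h : S.IsJointState ρ) :
    ρ = S.jointMatrix := by
  ext x y
  have := h.2 (Matrix.single y.1 x.1 1) (Matrix.single y.2 x.2 1)
  rw [Matrix.single_kronecker_single, Matrix.trace_mul_single] at this
  simpa [jointMatrix] using this

variable {S}

/-- Each matrix unit factors as `E_yx = E_ya₀ E_xa₀†`. Commuting the `A` and `B` factors gives the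
entry `(x, y)` as `tr (G_x† ρ_in G_y)`, a Gram matrix for the positive form defined by `ρ_in`. -/
theorem jointMatrix_posSemidef (hS : S.Spacelike) : S.jointMatrix.PosSemidef := by
  rcases isEmpty_or_nonempty (A × B) with _ | ⟨a₀, b₀⟩
  · rw [Subsingleton.elim S.jointMatrix 0]
    exact Matrix.PosSemidef.zero
  · set G : A × B → Matrix (A × A') (A × A') ℂ := fun x =>
      (Matrix.single x.1 a₀ 1 ⊗ₖ (1 : Matrix A' A' ℂ)) * S.heisenberg (Matrix.single x.2 b₀ 1)
    have hG : ∀ x y, (Matrix.single y.1 x.1 1 ⊗ₖ (1 : Matrix A' A' ℂ)) *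
        S.heisenberg (Matrix.single y.2 x.2 1) = G y * (G x)ᴴ := by
      intro x y
      have h1 : (Matrix.single y.1 x.1 1 : Matrix A A ℂ) ⊗ₖ (1 : Matrix A' A' ℂ) =
          (Matrix.single y.1 a₀ 1 ⊗ₖ 1) * (Matrix.single x.1 a₀ 1 ⊗ₖ 1)ᴴ := by
        rw [Matrix.conjTranspose_kronecker, ← Matrix.mul_kronecker_mul]
        simp
      have h2 : S.heisenberg (Matrix.single y.2 x.2 1) =
          S.heisenberg (Matrix.single y.2 b₀ 1) * (S.heisenberg (Matrix.single x.2 b₀ 1))ᴴ := by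
        rw [heisenberg_conjTranspose, ← heisenberg_mul]
        simp
      have h3 : (Matrix.single x.1 a₀ 1 ⊗ₖ (1 : Matrix A' A' ℂ))ᴴ *
          S.heisenberg (Matrix.single y.2 x.2 1) = S.heisenberg (Matrix.single y.2 x.2 1) *
            (Matrix.single x.1 a₀ 1 ⊗ₖ (1 : Matrix A' A' ℂ))ᴴ := by
        rw [Matrix.conjTranspose_kronecker, Matrix.conjTranspose_one]
        exact hS _ _
      simp only [G, Matrix.conjTranspose_mul]
      rw [h1, Matrix.mul_assoc, h3, h2]
      simp only [Matrix.mul_assoc]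
    have : S.jointMatrix = ∑ i, (Matrix.of fun s x => G x s i)ᴴ * S.rho *
        (Matrix.of fun s x => G x s i) := by
      ext x y
      have h1 : S.jointMatrix x y = ((G x)ᴴ * S.rho * G y).trace := by
        rw [jointMatrix, Matrix.of_apply, hG, ← Matrix.mul_assoc, Matrix.trace_mul_comm,
          ← Matrix.mul_assoc]
      rw [h1, Matrix.sum_apply, Matrix.trace]
      refine Finset.sum_congr rfl fun i _ => ?_
      simp only [Matrix.diag_apply, Matrix.mul_apply, Matrix.conjTranspose_apply, Matrix.of_apply]
    rw [this]
    exact Matrix.posSemidef_sum _ fun i _ => S.isDensity.1.conjTranspose_mul_mul_same _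

theorem isJointState_jointMatrix (hS : S.Spacelike) : S.IsJointState S.jointMatrix := by
  refine ⟨⟨jointMatrix_posSemidef hS, ?_⟩, S.trace_jointMatrix_mul⟩
  have := S.trace_jointMatrix_mul 1 1
  rwa [Matrix.one_kronecker_one, Matrix.mul_one, Matrix.one_kronecker_one, heisenberg_one,
    Matrix.mul_one, Matrix.mul_one, S.isDensity.2] at this

variable (S) in
theorem traceLeft_jointMatrix : traceLeft S.jointMatrix = S.rhoB0 := by
  rw [Matrix.ext_iff_trace_mul_left]
  intro Y
  rw [trace_mul_traceLeft, Matrix.trace_mul_comm, trace_jointMatrix_mul, Matrix.one_kronecker_one,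
    Matrix.one_mul, rhoB0, trace_mul_traceRight, heisenberg, Matrix.mul_assoc S.Uᴴ,
    ← Matrix.mul_assoc, Matrix.trace_mul_comm]
  rw [Matrix.mul_assoc, Matrix.trace_mul_comm]
  rw [Matrix.trace_mul_comm]
  simp only [Matrix.mul_assoc]

/-- For spacelike separated regions the Heisenberg operators act on `A'` only. -/
theorem heisenberg_apply_of_ne (hS : S.Spacelike) (Y : Matrix B B ℂ) {a c : A} (h : a ≠ c)
    (x y : A') : S.heisenberg Y (a, x) (c, y) = 0 := by
  have h1 := congrFun (congrFun (hS (Matrix.single a a 1) Y) (a, x)) (c, y)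
  rw [Matrix.mul_apply, Matrix.mul_apply, Finset.sum_eq_single (a, x),
    Finset.sum_eq_zero] at h1
  · simpa using h1
  · rintro ⟨d, z⟩ _
    simp [h]
  · rintro ⟨d, z⟩ _ hd
    rw [Matrix.kroneckerMap_apply]
    by_cases hda : a = d
    · have : x ≠ z := fun hz => hd (by rw [hda, hz])
      simp [Matrix.one_apply_ne this]
    · simp [hda]
  · simp

/-- Commutation with the unit `E_ac` makes the diagonal blocks independent of the index in `A`; with
the vanishing of the off-diagonal blocks, the operator is `1 ⊗ Y'`. -/
theorem heisenberg_apply_diag (hS : S.Spacelike) (Y : Matrix B B ℂ) (a c : A)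
    (x y : A') : S.heisenberg Y (a, x) (a, y) = S.heisenberg Y (c, x) (c, y) := by
  have h1 := congrFun (congrFun (hS (Matrix.single a c 1) Y) (a, x)) (c, y)
  rw [Matrix.mul_apply, Matrix.mul_apply, Finset.sum_eq_single (c, x),
    Finset.sum_eq_single (a, y)] at h1
  · simpa using h1.symm
  · rintro ⟨d, z⟩ _ hd
    rw [Matrix.kroneckerMap_apply]
    by_cases hda : a = d
    · have : z ≠ y := fun hz => hd (by rw [hda, hz])
      simp [Matrix.one_apply_ne this]
    · simp [hda]
  · simp
  · rintro ⟨d, z⟩ _ hd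
    rw [Matrix.kroneckerMap_apply]
    by_cases hda : c = d
    · have : x ≠ z := fun hz => hd (by rw [hda, hz])
      simp [Matrix.one_apply_ne this]
    · simp [hda]
  · simp

theorem jointMatrix_apply (hS : S.Spacelike) (a c : A) (b b' : B) :
    S.jointMatrix (a, b) (c, b') = ∑ x, ∑ y, S.rho (a, x) (c, y) *
      S.heisenberg (Matrix.single b' b 1) (a, y) (a, x) := by
  have h1 : ∀ s t : A × A', ((Matrix.single c a (1 : ℂ) ⊗ₖ (1 : Matrix A' A' ℂ)) *
      S.heisenberg (Matrix.single b' b 1)) s t =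
      if s.1 = c then S.heisenberg (Matrix.single b' b 1) (a, s.2) t else 0 := by
    rintro ⟨d, y⟩ t
    rw [Matrix.mul_apply, Finset.sum_eq_single (a, y)]
    · by_cases hd : d = c
      · simp [hd]
      · have : c ≠ d := fun h => hd h.symm
        simp [hd, this]
    · rintro ⟨e, z⟩ _ he
      rw [Matrix.kroneckerMap_apply]
      by_cases hda : a = e
      · have : y ≠ z := fun hz => he (by rw [hda, hz])
        simp [Matrix.one_apply_ne this]
      · simp [hda]
    · simp
  rw [jointMatrix, Matrix.of_apply, Matrix.trace, Fintype.sum_prod_type, Finset.sum_eq_single a]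
  · refine Finset.sum_congr rfl fun x _ => ?_
    rw [Matrix.diag_apply, Matrix.mul_apply, Fintype.sum_prod_type, Finset.sum_eq_single c]
    · exact Finset.sum_congr rfl fun y _ => by rw [h1]; simp
    · intro d _ hd
      exact Finset.sum_eq_zero fun y _ => by rw [h1]; simp [hd]
    · simp
  · intro e _ he
    refine Finset.sum_eq_zero fun x _ => ?_
    rw [Matrix.diag_apply, Matrix.mul_apply]
    refine Finset.sum_eq_zero fun s _ => ?_
    rw [h1, heisenberg_apply_of_ne hS _ he.symm]
    simp
  · simp

end System

/-! ### The connected state -/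

namespace Coupling

variable {X : Type u} [Fintype X] [DecidableEq X] (C : Coupling X)

/-- The isometry `V (1 ⊗ |φ⟩)` from the system to the system and the ancilla. -/
def isometry : Matrix (X × C.W) X ℂ :=
  Matrix.of fun s x => ∑ w, C.V s (x, w) * C.phi w

theorem isometry_eq : C.isometry =
    C.V * (Matrix.of fun s x => (1 : Matrix X X ℂ) s.1 x * C.phi s.2 :
      Matrix (X × C.W) X ℂ) := by
  ext s x
  rw [isometry, Matrix.of_apply, Matrix.mul_apply, Fintype.sum_prod_type,
    Finset.sum_eq_single x]
  · simp
  · intro y _ hy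
    simp [hy]
  · simp

theorem conjTranspose_mul_isometry : C.isometryᴴ * C.isometry = 1 := by
  have hphi : ∑ w, star (C.phi w) * C.phi w = 1 := by
    have h := congrArg (fun r : ℝ => (r : ℂ)) C.norm_phi
    simp only [Complex.ofReal_sum, Complex.ofReal_one, Complex.ofReal_pow] at h
    rw [← h]
    exact Finset.sum_congr rfl fun w _ => Complex.conj_mul' _
  have hV : C.Vᴴ * C.V = 1 := Matrix.mem_unitaryGroup_iff'.1 C.unitary
  rw [isometry_eq, Matrix.conjTranspose_mul, Matrix.mul_assoc, ← Matrix.mul_assoc C.Vᴴ, hV,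
    Matrix.one_mul]
  ext x y
  rw [Matrix.mul_apply, Fintype.sum_prod_type, Finset.sum_eq_single x]
  · simp only [Matrix.conjTranspose_apply, Matrix.of_apply, Matrix.one_apply_eq, one_mul]
    calc _ = (1 : Matrix X X ℂ) x y * ∑ w, star (C.phi w) * C.phi w := by
          rw [Finset.mul_sum]
          exact Finset.sum_congr rfl fun w _ => by ring
      _ = _ := by rw [hphi, mul_one]
  · intro z _ hz
    simp [Matrix.conjTranspose_apply, hz]
  · simp

/-- The isometry of a coupling, acting on the first factor of `X ⊗ Y`. -/
def isometryLeft {Y Z : Type*} [DecidableEq Y] (e : Z ≃ X × Y) : Matrix (X × (Y × C.W)) Z ℂ :=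
  Matrix.of fun s z => C.isometry (s.1, s.2.2) (e z).1 * (1 : Matrix Y Y ℂ) s.2.1 (e z).2

variable {Y Z : Type*} [Fintype Y] [DecidableEq Y] [Fintype Z] [DecidableEq Z] (e : Z ≃ X × Y)

theorem isometryLeft_apply (a x : X) (y y' : Y) (w : C.W) :
    C.isometryLeft e (a, (y, w)) (e.symm (x, y')) =
      C.isometry (a, w) x * if y = y' then 1 else 0 := by
  rw [isometryLeft, Matrix.of_apply, Equiv.apply_symm_apply]
  rfl

theorem conjTranspose_mul_isometryLeft : (C.isometryLeft e)ᴴ * C.isometryLeft e = 1 := by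
  ext z z'
  have h : ((C.isometryLeft e)ᴴ * C.isometryLeft e) z z' =
      (C.isometryᴴ * C.isometry) (e z).1 (e z').1 * (1 : Matrix Y Y ℂ) (e z).2 (e z').2 := by
    simp only [Matrix.mul_apply, Fintype.sum_prod_type, Finset.sum_mul]
    refine Finset.sum_congr rfl fun x _ => ?_
    rw [Finset.sum_eq_single (e z).2]
    · simp [isometryLeft, mul_assoc]
    · intro y _ hy
      simp [isometryLeft, Matrix.one_apply_ne hy]
    · simp
  rw [h, conjTranspose_mul_isometry, Matrix.one_apply, Matrix.one_apply, Matrix.one_apply]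
  by_cases hz : z = z'
  · simp [hz]
  · by_cases h1 : (e z).1 = (e z').1
    · have : (e z).2 ≠ (e z').2 := fun h2 => hz (e.injective (Prod.ext h1 h2))
      simp [hz, this]
    · simp [hz, h1]

/-- The channel of the coupling in entries: the isometry acts on `X`, its output in `X` is
discarded, and the indices of `Y` pass through unchanged. -/
theorem traceLeft_isometryLeft (T : Matrix Z Z ℂ) (b b' : Y) (w w' : C.W) :
    traceLeft (C.isometryLeft e * T * (C.isometryLeft e)ᴴ) (b, w) (b', w') =
      ∑ a, ∑ x, ∑ y, C.isometry (a, w) x * T (e.symm (x, b)) (e.symm (y, b')) *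
        star (C.isometry (a, w') y) := by
  rw [traceLeft, Matrix.of_apply]
  refine Finset.sum_congr rfl fun a _ => ?_
  rw [Matrix.mul_apply, ← e.symm.sum_comp, Fintype.sum_prod_type, Finset.sum_comm]
  have h1 : ∀ z, (C.isometryLeft e * T) (a, (b, w)) z =
      ∑ x, C.isometry (a, w) x * T (e.symm (x, b)) z := by
    intro z
    rw [Matrix.mul_apply, ← e.symm.sum_comp, Fintype.sum_prod_type]
    refine Finset.sum_congr rfl fun x _ => ?_
    simp [isometryLeft_apply]
  rw [Finset.sum_eq_single b']
  · simp only [h1, Finset.sum_mul]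
    rw [Finset.sum_comm]
    refine Finset.sum_congr rfl fun x _ => Finset.sum_congr rfl fun y _ => ?_
    rw [Matrix.conjTranspose_apply, isometryLeft_apply, if_pos rfl, mul_one]
  · intro y _ hy
    refine Finset.sum_eq_zero fun x _ => ?_
    rw [Matrix.conjTranspose_apply, isometryLeft_apply, if_neg hy.symm, mul_zero, star_zero,
      mul_zero]
  · simp

end Coupling

/-- `(α ⊗ β)^N ≃ α^N ⊗ β^N`. -/
abbrev splitPow (N : ℕ) (α β : Type*) : (Fin N → α × β) ≃ (Fin N → α) × (Fin N → β) :=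
  Equiv.arrowProdEquivProdArrow (Fin N) (fun _ => α) (fun _ => β)

/-! ### The connected state as the image of copies of the joint state -/

namespace System

variable {A : Type u} {A' B B' : Type*} [Fintype A] [DecidableEq A] [Fintype A'] [DecidableEq A']
  [Fintype B] [DecidableEq B] [Fintype B'] [DecidableEq B'] {S : System A A' B B'}

theorem mul_kronecker_vecMulVec_mul_apply {m n w : Type*} [Fintype m] [Fintype n] [Fintype w]
    (M : Matrix m (n × w) ℂ) (R : Matrix n n ℂ) (v : w → ℂ) (s t : m) :
    (M * (R ⊗ₖ Matrix.vecMulVec v (star v)) * Mᴴ) s t =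
      ∑ x, ∑ y, (∑ i, M s (x, i) * v i) * R x y * star (∑ j, M t (y, j) * v j) := by
  have h1 : ∀ y j, (M * (R ⊗ₖ Matrix.vecMulVec v (star v))) s (y, j) =
      (∑ x, (∑ i, M s (x, i) * v i) * R x y) * star (v j) := by
    intro y j
    rw [Matrix.mul_apply, Fintype.sum_prod_type, Finset.sum_mul]
    refine Finset.sum_congr rfl fun x _ => ?_
    rw [Finset.sum_mul, Finset.sum_mul]
    refine Finset.sum_congr rfl fun i _ => ?_
    rw [Matrix.kroneckerMap_apply, Matrix.vecMulVec_apply, Pi.star_apply]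
    ring
  rw [Matrix.mul_apply, Fintype.sum_prod_type, Finset.sum_comm' (t' := Finset.univ)
    (s' := fun _ => Finset.univ) (by simp)]
  rw [Finset.sum_comm]
  conv_rhs => rw [Finset.sum_comm]
  refine Finset.sum_congr rfl fun y _ => ?_
  rw [← Finset.sum_mul, star_sum, Finset.mul_sum]
  refine Finset.sum_congr rfl fun j _ => ?_
  rw [h1, Matrix.conjTranspose_apply, star_mul']
  ring

theorem evolve_couple_apply (N : ℕ) (C : Coupling (Fin N → A)) (s : (Fin N → B × B') × C.W)
    (t : (Fin N → A × A') × C.W) :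
    ((tensorPow N S.U ⊗ₖ (1 : Matrix C.W C.W ℂ)) *
      (C.V ⊗ₖ (1 : Matrix (Fin N → A') (Fin N → A') ℂ)).submatrix
        (regroup N A A' C.W) (regroup N A A' C.W)) s t =
    ∑ a : Fin N → A, tensorPow N S.U s.1 (fun i => (a i, (t.1 i).2)) *
      C.V (a, s.2) (fun i => (t.1 i).1, t.2) := by
  rw [Matrix.mul_apply, ← (regroup N A A' C.W).symm.sum_comp, Fintype.sum_prod_type,
    Fintype.sum_prod_type]
  refine Finset.sum_congr rfl fun a _ => ?_
  rw [Finset.sum_eq_single s.2, Finset.sum_eq_single fun i => (t.1 i).2]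
  · simp [regroup]
  · intro x _ hx
    rw [Matrix.submatrix_apply, Equiv.apply_symm_apply, Matrix.kroneckerMap_apply,
      Matrix.kroneckerMap_apply]
    refine mul_eq_zero_of_right _ (mul_eq_zero_of_right _ (Matrix.one_apply_ne hx))
  · simp
  · intro w _ hw
    refine Finset.sum_eq_zero fun x _ => ?_
    simp [regroup, Matrix.one_apply_ne hw.symm]
  · simp

/-- Amplitudes of the coupled evolution. -/
def amplitude (S : System A A' B B') (N : ℕ) (C : Coupling (Fin N → A)) (s : Fin N → B × B')
    (w : C.W) (t : Fin N → A × A') : ℂ :=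
  ∑ a : Fin N → A, tensorPow N S.U s (fun i => (a i, (t i).2)) *
    C.isometry (a, w) fun i => (t i).1

theorem rhoBW_apply (N : ℕ) (C : Coupling (Fin N → A)) (s t : (Fin N → B) × C.W) :
    S.rhoBW N C s t = ∑ z : Fin N → B', ∑ x, ∑ y,
      S.amplitude N C (fun i => (s.1 i, z i)) s.2 x * tensorPow N S.rho x y *
        star (S.amplitude N C (fun i => (t.1 i, z i)) t.2 y) := by
  rw [rhoBW, traceRight, Matrix.of_apply]
  refine Finset.sum_congr rfl fun z _ => ?_
  rw [Matrix.submatrix_apply]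
  set M := (tensorPow N S.U ⊗ₖ (1 : Matrix C.W C.W ℂ)) *
      (C.V ⊗ₖ (1 : Matrix (Fin N → A') (Fin N → A') ℂ)).submatrix
        (regroup N A A' C.W) (regroup N A A' C.W) with hM
  have hamp : ∀ s x, S.amplitude N C s.1 s.2 x = ∑ w, M s (x, w) * C.phi w := by
    intro s x
    simp only [hM, evolve_couple_apply, Finset.sum_mul, amplitude, Coupling.isometry,
      Matrix.of_apply, Finset.mul_sum]
    rw [Finset.sum_comm]
    simp only [mul_assoc]
  have e1 : ∀ u : (Fin N → B) × C.W, (regroup N B B' C.W).symm (u, z) =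
    (fun i => (u.1 i, z i), u.2) := fun u => rfl
  rw [e1, e1]
  have hs := fun x => hamp (fun i => (s.1 i, z i), s.2) x
  have ht := fun x => hamp (fun i => (t.1 i, z i), t.2) x
  simp only at hs ht
  simp only [hs, ht]
  exact mul_kronecker_vecMulVec_mul_apply _ _ _ _ _

/-- Causality enters here. Summing over `B'^N` turns `U` and its conjugate into Heisenberg matrix
units; being of the form `1 ⊗ Y'`, they set the two outputs of the isometry in `A^N` equal and
otherwise ignore them. The index in `A` of the Heisenberg factor can thus be moved back to the input
`x`, separating coupling from evolution. -/
theorem sum_amplitude (hS : S.Spacelike) (N : ℕ) (C : Coupling (Fin N → A)) (b b' : Fin N → B)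
    (w w' : C.W) (x y : Fin N → A × A') :
    ∑ z : Fin N → B', S.amplitude N C (fun i => (b i, z i)) w x *
        star (S.amplitude N C (fun i => (b' i, z i)) w' y) =
      (∑ a, C.isometry (a, w) (fun i => (x i).1) * star (C.isometry (a, w') fun i => (y i).1)) *
        ∏ i, S.heisenberg (Matrix.single (b' i) (b i) 1) ((x i).1, (y i).2) ((x i).1, (x i).2) := by
  have hU : ∀ a c : Fin N → A, ∑ z : Fin N → B',
      tensorPow N S.U (fun i => (b i, z i)) (fun i => (a i, (x i).2)) *
        star (tensorPow N S.U (fun i => (b' i, z i)) (fun i => (c i, (y i).2))) =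
      if a = c then ∏ i, S.heisenberg (Matrix.single (b' i) (b i) 1)
        ((x i).1, (y i).2) ((x i).1, (x i).2) else 0 := by
    intro a c
    have h1 : ∑ z : Fin N → B',
        tensorPow N S.U (fun i => (b i, z i)) (fun i => (a i, (x i).2)) *
        star (tensorPow N S.U (fun i => (b' i, z i)) (fun i => (c i, (y i).2))) =
        ∏ i, S.heisenberg (Matrix.single (b' i) (b i) 1) (c i, (y i).2) (a i, (x i).2) := by
      simp only [heisenberg_single_apply]
      rw [Finset.prod_univ_sum, Fintype.piFinset_univ]
      refine Finset.sum_congr rfl fun z _ => ?_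
      simp only [tensorPow, Matrix.of_apply, star_prod, ← Finset.prod_mul_distrib]
      exact Finset.prod_congr rfl fun i _ => mul_comm _ _
    rw [h1]
    split_ifs with hac
    · subst hac
      exact Finset.prod_congr rfl fun i _ => heisenberg_apply_diag hS _ _ _ _ _
    · obtain ⟨i, hi⟩ := Function.ne_iff.1 hac
      exact Finset.prod_eq_zero (Finset.mem_univ i) (heisenberg_apply_of_ne hS _ hi.symm _ _)
  simp only [amplitude, star_sum, star_mul', Finset.sum_mul_sum]
  rw [Finset.sum_comm, Finset.sum_mul]
  refine Finset.sum_congr rfl fun a _ => ?_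
  rw [Finset.sum_comm, Finset.sum_eq_single a]
  · have h2 := hU a a
    rw [if_pos rfl] at h2
    rw [← h2, Finset.mul_sum]
    exact Finset.sum_congr rfl fun z _ => by ring
  · intro c _ hc
    have h2 := hU a c
    rw [if_neg hc.symm] at h2
    calc _ = (C.isometry (a, w) (fun i => (x i).1) *
            star (C.isometry (c, w') fun i => (y i).1)) * ∑ z : Fin N → B',
          tensorPow N S.U (fun i => (b i, z i)) (fun i => (a i, (x i).2)) *
          star (tensorPow N S.U (fun i => (b' i, z i)) (fun i => (c i, (y i).2))) := by
          rw [Finset.mul_sum]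
          exact Finset.sum_congr rfl fun z _ => by ring
      _ = 0 := by rw [h2, mul_zero]
  · simp

/-- The connected state is obtained from copies of the joint state by the isometry of the
coupling. -/
theorem rhoBW_eq (hS : S.Spacelike) (N : ℕ) (C : Coupling (Fin N → A)) :
    S.rhoBW N C = traceLeft (C.isometryLeft (splitPow N A B) * tensorPow N S.jointMatrix *
      (C.isometryLeft (splitPow N A B))ᴴ) := by
  ext ⟨b, w⟩ ⟨b', w'⟩
  rw [Coupling.traceLeft_isometryLeft, rhoBW_apply]
  calc _ = ∑ x, ∑ y, (∑ z : Fin N → B', S.amplitude N C (fun i => (b i, z i)) w x *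
        star (S.amplitude N C (fun i => (b' i, z i)) w' y)) * tensorPow N S.rho x y := by
        rw [Finset.sum_comm]
        refine Finset.sum_congr rfl fun x _ => ?_
        rw [Finset.sum_comm]
        refine Finset.sum_congr rfl fun y _ => ?_
        rw [Finset.sum_mul]
        exact Finset.sum_congr rfl fun z _ => by ring
    _ = ∑ a, ∑ x : Fin N → A × A', ∑ y : Fin N → A × A', C.isometry (a, w) (fun i => (x i).1) *
        star (C.isometry (a, w') fun i => (y i).1) *
        ∏ i, S.rho (x i) (y i) * S.heisenberg (Matrix.single (b' i) (b i) 1)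
          ((x i).1, (y i).2) ((x i).1, (x i).2) := by
        symm
        rw [Finset.sum_comm]
        refine Finset.sum_congr rfl fun x _ => ?_
        rw [Finset.sum_comm]
        refine Finset.sum_congr rfl fun y _ => ?_
        rw [sum_amplitude hS, Finset.sum_mul, Finset.sum_mul]
        refine Finset.sum_congr rfl fun a _ => ?_
        rw [Finset.prod_mul_distrib, tensorPow, Matrix.of_apply]
        ring
    _ = _ := by
        refine Finset.sum_congr rfl fun a _ => ?_
        rw [← (splitPow N A A').symm.sum_comp, Fintype.sum_prod_type]
        refine Finset.sum_congr rfl fun x _ => ?_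
        simp only [← (splitPow N A A').symm.sum_comp, Fintype.sum_prod_type]
        rw [Finset.sum_comm]
        refine Finset.sum_congr rfl fun y _ => ?_
        -- The sums over `A'^N` are exactly those in the entries of the joint state, one pair for
        -- each copy.
        have h1 : tensorPow N S.jointMatrix ((splitPow N A B).symm (x, b))
            ((splitPow N A B).symm (y, b')) = ∑ x' : Fin N → A', ∑ y' : Fin N → A',
            ∏ i, S.rho (x i, x' i) (y i, y' i) *
              S.heisenberg (Matrix.single (b' i) (b i) 1) (x i, y' i) (x i, x' i) := by
          rw [tensorPow, Matrix.of_apply]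
          simp only [Equiv.arrowProdEquivProdArrow, Equiv.coe_fn_symm_mk, jointMatrix_apply hS]
          rw [Finset.prod_univ_sum, Fintype.piFinset_univ]
          refine Finset.sum_congr rfl fun x' _ => ?_
          rw [Finset.prod_univ_sum, Fintype.piFinset_univ]
        rw [h1]
        simp only [Finset.mul_sum, Finset.sum_mul]
        refine Finset.sum_congr rfl fun x' _ => Finset.sum_congr rfl fun y' _ => ?_
        simp only [Equiv.arrowProdEquivProdArrow, Equiv.coe_fn_symm_mk]
        ring

end System

/-! ### Marginals of the channel output -/

namespace Coupling

variable {X : Type u} [Fintype X] [DecidableEq X] (C : Coupling X)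
variable {Y Z : Type*} [Fintype Y] [DecidableEq Y] [Fintype Z] [DecidableEq Z] (e : Z ≃ X × Y)

/-- Tracing out both outputs of the isometry leaves only `K† K = 1`, so the coupling drops out. -/
theorem traceRight_traceLeft_isometryLeft (T : Matrix Z Z ℂ) (b b' : Y) :
    traceRight (traceLeft (C.isometryLeft e * T * (C.isometryLeft e)ᴴ)) b b' =
      ∑ x, T (e.symm (x, b)) (e.symm (x, b')) := by
  have hK : ∀ x y, ∑ w, ∑ a, star (C.isometry (a, w) y) * C.isometry (a, w) x =
      if y = x then 1 else 0 := by
    intro x y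
    have h := congrFun (congrFun C.conjTranspose_mul_isometry y) x
    rw [Matrix.mul_apply, Fintype.sum_prod_type, Finset.sum_comm, Matrix.one_apply] at h
    exact h
  rw [traceRight, Matrix.of_apply]
  simp only [traceLeft_isometryLeft]
  calc _ = ∑ x, ∑ y, (∑ w, ∑ a, star (C.isometry (a, w) y) * C.isometry (a, w) x) *
        T (e.symm (x, b)) (e.symm (y, b')) := by
        simp only [Finset.sum_mul]
        symm
        rw [Finset.sum_congr rfl fun x _ => Finset.sum_comm, Finset.sum_comm]
        refine Finset.sum_congr rfl fun w _ => ?_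
        rw [Finset.sum_congr rfl fun x _ => Finset.sum_comm, Finset.sum_comm]
        refine Finset.sum_congr rfl fun a _ => Finset.sum_congr rfl fun x _ =>
          Finset.sum_congr rfl fun y _ => ?_
        ring
    _ = _ := by
        refine Finset.sum_congr rfl fun x _ => ?_
        simp only [hK, ite_mul, one_mul, zero_mul, Finset.sum_ite_eq', Finset.mem_univ, if_true]

theorem traceLeft_traceLeft_isometryLeft (T : Matrix Z Z ℂ) (w w' : C.W) :
    traceLeft (traceLeft (C.isometryLeft e * T * (C.isometryLeft e)ᴴ)) w w' =
      ∑ a, ∑ x, ∑ y, C.isometry (a, w) x * (∑ b, T (e.symm (x, b)) (e.symm (y, b))) *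
        star (C.isometry (a, w') y) := by
  rw [traceLeft, Matrix.of_apply]
  simp only [traceLeft_isometryLeft, Finset.mul_sum, Finset.sum_mul]
  rw [Finset.sum_comm]
  refine Finset.sum_congr rfl fun a _ => ?_
  rw [Finset.sum_comm]
  refine Finset.sum_congr rfl fun x _ => ?_
  rw [Finset.sum_comm]

end Coupling

/-! ### No signalling, the upper bound, and its attainment by the swap -/

namespace System

variable {A : Type u} {A' B B' : Type*} [Fintype A] [DecidableEq A] [Fintype A'] [DecidableEq A']
  [Fintype B] [DecidableEq B] [Fintype B'] [DecidableEq B'] {S : System A A' B B'}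

/-- Operations on `A` do not affect `B`. -/
theorem traceRight_rhoBW (hS : S.Spacelike) (N : ℕ) (C : Coupling (Fin N → A)) :
    traceRight (S.rhoBW N C) = tensorPow N S.rhoB0 := by
  ext b b'
  rw [rhoBW_eq hS, Coupling.traceRight_traceLeft_isometryLeft, ← traceLeft_jointMatrix,
    tensorPow_traceLeft]
  rfl

theorem rhoBW_posSemidef (hS : S.Spacelike) (N : ℕ) (C : Coupling (Fin N → A)) :
    (S.rhoBW N C).PosSemidef := by
  rw [rhoBW_eq hS]
  exact traceLeft_posSemidef
    ((tensorPow_posSemidef N (jointMatrix_posSemidef hS)).mul_mul_conjTranspose_same _)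

theorem tensorPow_kronecker_apply {α β : Type*} (N : ℕ) (M : Matrix α α ℂ) (M' : Matrix β β ℂ)
    (x y : Fin N → α) (b b' : Fin N → β) :
    tensorPow N (M ⊗ₖ M') ((splitPow N α β).symm (x, b)) ((splitPow N α β).symm (y, b')) =
      tensorPow N M x y * tensorPow N M' b b' := by
  simp only [tensorPow, Matrix.of_apply, ← Finset.prod_mul_distrib]
  rfl

/-- The disconnected state, obtained from the product of the marginals of the joint state. -/
theorem rhoBW_marginals_eq (hS : S.Spacelike) (N : ℕ) (C : Coupling (Fin N → A)) :
    tensorPow N S.rhoB0 ⊗ₖ traceLeft (S.rhoBW N C) =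
      traceLeft (C.isometryLeft (splitPow N A B) *
        tensorPow N (traceRight S.jointMatrix ⊗ₖ traceLeft S.jointMatrix) *
        (C.isometryLeft (splitPow N A B))ᴴ) := by
  ext ⟨b, w⟩ ⟨b', w'⟩
  rw [Coupling.traceLeft_isometryLeft, Matrix.kroneckerMap_apply, rhoBW_eq hS,
    Coupling.traceLeft_traceLeft_isometryLeft, Finset.mul_sum, ← traceLeft_jointMatrix]
  refine Finset.sum_congr rfl fun a _ => ?_
  rw [Finset.mul_sum]
  refine Finset.sum_congr rfl fun x _ => ?_
  rw [Finset.mul_sum]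
  refine Finset.sum_congr rfl fun y _ => ?_
  rw [tensorPow_kronecker_apply, tensorPow_traceRight]
  change tensorPow N (traceLeft S.jointMatrix) b b' * (C.isometry (a, w) x *
    (∑ b : Fin N → B, ∏ i, S.jointMatrix (x i, b i) (y i, b i)) *
    star (C.isometry (a, w') y)) = _
  ring

theorem relEntropy_tensorPow_jointMatrix (hS : S.Spacelike) (N : ℕ) :
    relEntropy (tensorPow N S.jointMatrix)
      (tensorPow N (traceRight S.jointMatrix ⊗ₖ traceLeft S.jointMatrix)) =
      ((N * mutualInfo S.jointMatrix : ℝ) : EReal) := by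
  have hρ := (isJointState_jointMatrix hS).1
  have hσ := (traceRight_posSemidef hρ.1).kronecker (traceLeft_posSemidef hρ.1)
  have hs := support_marginals hρ.1
  rw [relEntropy, if_pos (support_tensorPow N hρ.1 hσ hs),
    trace_relEntropy_tensorPow N hρ hσ hs, trace_relEntropy_marginals hρ.1]

theorem couplingRelEntropy_le (hS : S.Spacelike) (N : ℕ) (C : Coupling (Fin N → A)) :
    S.couplingRelEntropy N C ≤ ((N * mutualInfo S.jointMatrix : ℝ) : EReal) := by
  have hρ := (isJointState_jointMatrix hS).1
  have hσ := (traceRight_posSemidef hρ.1).kronecker (traceLeft_posSemidef hρ.1)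
  have hs := support_marginals hρ.1
  -- The disconnected state is the product of the marginals of the connected one, so the relative
  -- entropy is finite.
  have hs' := support_marginals (rhoBW_posSemidef hS N C)
  rw [traceRight_rhoBW hS] at hs'
  rw [couplingRelEntropy, relEntropy, if_pos hs', EReal.coe_le_coe_iff,
    ← trace_relEntropy_marginals hρ.1, ← trace_relEntropy_tensorPow N hρ hσ hs]
  rw [rhoBW_marginals_eq hS] at hs' ⊢
  rw [rhoBW_eq hS] at hs' ⊢
  exact trace_relEntropy_traceLeft_le (C.conjTranspose_mul_isometryLeft _)
    (tensorPow_posSemidef N hρ.1) (tensorPow_posSemidef N hσ) (support_tensorPow N hρ.1 hσ hs) hs'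

theorem isometry_swapCoupling {X : Type u} [Fintype X] [DecidableEq X] (phi : X → ℂ)
    (h : ∑ x, ‖phi x‖ ^ 2 = 1) (a w x : X) :
    (swapCoupling phi h).isometry (a, w) x = if w = x then phi a else 0 := by
  change ∑ v, swapMatrix X (a, w) (x, v) * phi v = _
  have h1 : ∀ v, swapMatrix X (a, w) (x, v) = if (w, a) = (x, v) then 1 else 0 := fun v => rfl
  simp only [h1, Prod.mk.injEq]
  by_cases hw : w = x <;> simp [hw]

/-- The swap leaves `φ` in the discarded factor, where it contributes its norm `1`, and puts `A^N`
in the ancilla. The channel is then a mere relabelling `e` of the basis, which preserves relative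
entropy. -/
theorem couplingRelEntropy_swapCoupling (hS : S.Spacelike) (N : ℕ) (phi : (Fin N → A) → ℂ)
    (h : ∑ x, ‖phi x‖ ^ 2 = 1) :
    S.couplingRelEntropy N (swapCoupling phi h) =
      ((N * mutualInfo S.jointMatrix : ℝ) : EReal) := by
  have hρ := (isJointState_jointMatrix hS).1
  have hphi : ∑ x, phi x * star (phi x) = 1 := by
    have h' := congrArg (fun r : ℝ => (r : ℂ)) h
    simp only [Complex.ofReal_sum, Complex.ofReal_one, Complex.ofReal_pow] at h'
    rw [← h']
    exact Finset.sum_congr rfl fun w _ => Complex.mul_conj' _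
  let e : (Fin N → B) × (Fin N → A) ≃ (Fin N → A × B) :=
    (Equiv.prodComm _ _).trans (splitPow N A B).symm
  -- The kernel `K` is arbitrary so that its ancilla index has type `Fin N → A` on the nose, to
  -- which the ancilla type of `swapCoupling` only unfolds.
  have hsum : ∀ (K : (Fin N → A) → (Fin N → A) → (Fin N → A) → ℂ)
      (_ : ∀ a w x, K a w x = if w = x then phi a else 0)
      (T : Matrix (Fin N → A × B) (Fin N → A × B) ℂ) (b b' : Fin N → B) (w w' : Fin N → A),
      ∑ a, ∑ x, ∑ y, K a w x * T ((splitPow N A B).symm (x, b)) ((splitPow N A B).symm (y, b')) *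
        star (K a w' y) = T ((splitPow N A B).symm (w, b)) ((splitPow N A B).symm (w', b')) := by
    intro K hK T b b' w w'
    rw [← one_mul (T ((splitPow N A B).symm (w, b)) _), ← hphi, Finset.sum_mul]
    refine Finset.sum_congr rfl fun a _ => ?_
    rw [Finset.sum_eq_single w, Finset.sum_eq_single w']
    · rw [hK, hK, if_pos rfl, if_pos rfl]
      ring
    · intro y _ hy
      rw [hK a w', if_neg hy.symm, star_zero, mul_zero]
    · simp
    · intro x _ hx
      refine Finset.sum_eq_zero fun y _ => ?_
      rw [hK a w, if_neg hx.symm, zero_mul, zero_mul]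
    · simp
  have key : ∀ T : Matrix (Fin N → A × B) (Fin N → A × B) ℂ,
      traceLeft ((swapCoupling phi h).isometryLeft (splitPow N A B) * T *
        ((swapCoupling phi h).isometryLeft (splitPow N A B))ᴴ) = T.submatrix e e := by
    intro T
    ext ⟨b, w⟩ ⟨b', w'⟩
    rw [Coupling.traceLeft_isometryLeft]
    exact hsum (fun a w x => (swapCoupling phi h).isometry (a, w) x)
      (isometry_swapCoupling phi h) T b b' w w'
  rw [couplingRelEntropy, rhoBW_marginals_eq hS, rhoBW_eq hS, key, key,
    ← relEntropy_tensorPow_jointMatrix hS]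
  exact relEntropy_submatrix (tensorPow_posSemidef N hρ.1) (tensorPow_posSemidef N
    ((traceRight_posSemidef hρ.1).kronecker (traceLeft_posSemidef hρ.1))) e

theorem nonempty_left (S : System A A' B B') : Nonempty A := by
  by_contra h
  rw [not_nonempty_iff] at h
  have := S.isDensity.2
  simp [Matrix.trace] at this

theorem iSup_couplingRelEntropy (hS : S.Spacelike) (N : ℕ) :
    ⨆ C : Coupling (Fin N → A), S.couplingRelEntropy N C =
      ((N * mutualInfo S.jointMatrix : ℝ) : EReal) := by
  obtain ⟨a⟩ := S.nonempty_left
  refine le_antisymm (iSup_le fun C => couplingRelEntropy_le hS N C) ?_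
  -- Any unit vector would do; a basis vector exists because trace one excludes an empty `A`.
  have h : ∑ x, ‖(Pi.single (fun _ : Fin N => a) 1 : (Fin N → A) → ℂ) x‖ ^ 2 = 1 := by
    rw [Finset.sum_eq_single fun _ => a]
    · simp
    · intro x _ hx
      simp [hx]
    · simp
  rw [← couplingRelEntropy_swapCoupling hS N _ h]
  exact le_iSup (fun C => S.couplingRelEntropy N C) (swapCoupling _ h)

theorem J_eq (hS : S.Spacelike) {N : ℕ} (hN : 1 ≤ N) :
    S.J N = ((mutualInfo S.jointMatrix : ℝ) : EReal) := by
  have : (N : ℝ) ≠ 0 := Nat.cast_ne_zero.2 (by omega)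
  rw [J, iSup_couplingRelEntropy hS, ← EReal.coe_mul]
  congr 1
  field_simp

end System

end STMI

end

theorem mainTheorem4 {A : Type u} {A' B B' : Type*} [Fintype A] [DecidableEq A]
    [Fintype A'] [DecidableEq A'] [Fintype B] [DecidableEq B] [Fintype B'] [DecidableEq B']
    (S : STMI.System A A' B B') (hS : S.Spacelike) :
    (∃! ρ : Matrix (A × B) (A × B) ℂ, S.IsJointState ρ) ∧
    ∀ ρ : Matrix (A × B) (A × B) ℂ, S.IsJointState ρ → ∀ N : ℕ, 1 ≤ N →
      (∀ C : STMI.Coupling (Fin N → A),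
        STMI.traceRight (S.rhoBW N C) = STMI.tensorPow N S.rhoB0) ∧
      S.J N = ((STMI.mutualInfo ρ : ℝ) : EReal) ∧
      ∀ (phi : (Fin N → A) → ℂ) (hphi : ∑ x, ‖phi x‖ ^ 2 = 1),
        S.couplingRelEntropy N (STMI.swapCoupling phi hphi) =
          ⨆ C : STMI.Coupling (Fin N → A), S.couplingRelEntropy N C := by
  refine ⟨⟨S.jointMatrix, STMI.System.isJointState_jointMatrix hS, fun ρ hρ =>
    S.eq_jointMatrix hρ⟩, ?_⟩
  intro ρ hρ N hN
  rw [S.eq_jointMatrix hρ]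
  refine ⟨STMI.System.traceRight_rhoBW hS N, STMI.System.J_eq hS hN, fun phi hphi => ?_⟩
  rw [STMI.System.couplingRelEntropy_swapCoupling hS, STMI.System.iSup_couplingRelEntropy hS]
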